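/- Let $(S_m)_{m\ge 0}$ and $(\tilde S_m)_{m\ge 0}$ be two independent simple random walks on $\mathbb{Z}^4$ started at the origin (i.i.d. increments, uniform on the $8$ nearest neighbours of the origin), with Green's function $G(x,y)=\sum_{i=0}^\infty P^x(S_i=y)$. Let $(\beta_s)_{s\ge 0}$ and $(\tilde\beta_s)_{s\ge 0}$ be two independent standard $4$-dimensional Brownian motions started at the origin, with Green's function $G_\beta(x,y)=\frac{1}{2\pi^2}|x-y|^{-2}$ (equal to $+\infty$ for $x=y$), where $|\cdot|$ is the Euclidean norm. For $n\ge 1$ put $$X_n:=\frac1n\sum_{i,\ell\in[1,n]}G(S_i,\tilde S_\ell),\qquad Y:=\int_0^1\int_0^1 G_\beta(\beta_s,\tilde\beta_t)\,ds\,dt .$$ Then $X_n$ ($n\ge 1$) and $Y$ are $[0,\infty]$-valued random variables (measurable up to null sets), and there is an absolute constant $C\in(0,\infty)$ such that for all integers $p\ge 0$ and $n\ge 1$, $$E[X_n^p]\le C^p\,p!,\qquad E[Y^p]\le C^p\,p!.$$ Consequently, for the same $C$ and every real $c<1/C$, $$\sup_{n\ge 1}E[e^{cX_n}]<\infty,\qquad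 E[e^{cY}]<\infty .$$ -/

import Mathlib

open MeasureTheory ProbabilityTheory
open scoped NNReal ENNReal

namespace SRW4

noncomputable section

/-- The law of one step of simple random walk on `ℤ^d`: uniform on the `2d` neighbours
`±e_1, …, ±e_d` of the origin. -/
def stepLaw (d : ℕ) : Measure (Fin d → ℤ) :=
  (2 * d : ℝ≥0∞)⁻¹ • ∑ i : Fin d,
    (Measure.dirac (Pi.single i (1 : ℤ)) + Measure.dirac (-Pi.single i (1 : ℤ)))

/-- `S` is a simple random walk on `ℤ^d` started at the origin: its increments are
independent and uniform on the neighbours of the origin. -/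
structure IsSRW {Ω : Type*} [MeasurableSpace Ω] {d : ℕ}
    (S : ℕ → Ω → (Fin d → ℤ)) (P : Measure Ω) : Prop where
  measurable : ∀ n, Measurable (S n)
  zero : ∀ᵐ ω ∂P, S 0 ω = 0
  indep_steps : iIndepFun (fun (n : ℕ) ω ↦ S (n + 1) ω - S n ω) P
  law_step : ∀ n, HasLaw (fun ω ↦ S (n + 1) ω - S n ω) (stepLaw d) P

/-- The law of `S_n` under `P^x`, the law of simple random walk on `ℤ^d` started at `x`. -/
def walkLaw {d : ℕ} (x : Fin d → ℤ) : ℕ → Measure (Fin d → ℤ)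
  | 0 => Measure.dirac x
  | n + 1 => (walkLaw x n).conv (stepLaw d)

/-- Green's function `G(x, y) = ∑_{i ≥ 0} P^x(S_i = y)` of simple random walk, as an extended
nonnegative number. -/
def greenSRW {d : ℕ} (x y : Fin d → ℤ) : ℝ≥0∞ :=
  ∑' i : ℕ, walkLaw x i {y}

/-- `X_n = n⁻¹ ∑_{1 ≤ i, ℓ ≤ n} G(S_i, S̃_ℓ)`, for `n ≥ 1`. -/
def walkEnergy {Ω : Type*} {d : ℕ} (S S' : ℕ → Ω → (Fin d → ℤ)) (n : ℕ) (ω : Ω) : ℝ≥0∞ :=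
  (n : ℝ≥0∞)⁻¹ * ∑ i ∈ Finset.Icc 1 n, ∑ l ∈ Finset.Icc 1 n, greenSRW (S i ω) (S' l ω)

/-- `B` is a standard `d`-dimensional Brownian motion: it starts at the origin, has independent
increments, `B t - B s` is distributed as `√(t - s) Z` with `Z` a standard Gaussian vector of
`ℝ^d` (that is, as `N(0, (t - s) I_d)`), and its paths are almost surely continuous. -/
structure IsBrownianMotion {Ω : Type*} [MeasurableSpace Ω] {d : ℕ}
    (B : ℝ≥0 → Ω → EuclideanSpace ℝ (Fin d)) (P : Measure Ω) : Prop where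
  measurable : ∀ t, Measurable (B t)
  zero : ∀ᵐ ω ∂P, B 0 ω = 0
  indep_increments : HasIndepIncrements B P
  law_increment : ∀ s t : ℝ≥0, s ≤ t →
    HasLaw (fun ω ↦ B t ω - B s ω)
      ((stdGaussian (EuclideanSpace ℝ (Fin d))).map fun z ↦ √((t : ℝ) - s) • z) P
  continuous_paths : ∀ᵐ ω ∂P, Continuous fun t ↦ B t ω

/-- Green's function `(2π²)⁻¹ |x - y|⁻²` of 4-dimensional Brownian motion, with the value `∞`
at `x = y`. -/
def greenBM (x y : EuclideanSpace ℝ (Fin 4)) : ℝ≥0∞ :=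
  ENNReal.ofReal (1 / (2 * Real.pi ^ 2)) * (‖x - y‖ₑ ^ 2)⁻¹

/-- `Y = ∫₀¹ ∫₀¹ G_β(β_s, β̃_t) ds dt`. -/
def brownianEnergy {Ω : Type*} (B B' : ℝ≥0 → Ω → EuclideanSpace ℝ (Fin 4)) (ω : Ω) : ℝ≥0∞ :=
  ∫⁻ s in Set.Icc (0 : ℝ) 1, ∫⁻ t in Set.Icc (0 : ℝ) 1,
    greenBM (B s.toNNReal ω) (B' t.toNNReal ω)

/-- `E[e^{cZ}]` for a `[0, ∞]`-valued random variable `Z` and a real `c`; here `EReal.exp` is the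
exponential with `e^∞ = ∞` and `e^{-∞} = 0`. -/
def expMoment {Ω : Type*} [MeasurableSpace Ω] (P : Measure Ω) (Z : Ω → ℝ≥0∞) (c : ℝ) : ℝ≥0∞ :=
  ∫⁻ ω, EReal.exp ((c : EReal) * (Z ω : EReal)) ∂P

end

end SRW4

/-! ### Integrals over finite products -/

namespace MeasureTheory

theorem lintegral_pi_fin_succ {n : ℕ} {α : Type*} [MeasurableSpace α]
    (μ : Fin (n + 1) → Measure α) [∀ i, SigmaFinite (μ i)] {f : (Fin (n + 1) → α) → ℝ≥0∞}
    (hf : Measurable f) :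
    ∫⁻ x, f x ∂(Measure.pi μ) =
      ∫⁻ a, ∫⁻ x, f (Fin.cons a x : Fin (n + 1) → α) ∂(Measure.pi fun i ↦ μ i.succ) ∂(μ 0) := by
  rw [← (measurePreserving_piFinSuccAbove μ 0).symm.lintegral_comp hf, lintegral_prod]
  · simp_rw [MeasurableEquiv.piFinSuccAbove_symm_apply, Fin.insertNthEquiv, Fin.insertNth_zero,
      Equiv.coe_fn_mk, Fin.zero_succAbove]
    rfl
  · exact (hf.comp (MeasurableEquiv.measurable _)).aemeasurable

theorem lintegral_fin_prod_eq_prod {n : ℕ} {α : Type*} [MeasurableSpace α]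
    (μ : Fin n → Measure α) [∀ i, SigmaFinite (μ i)] {f : Fin n → α → ℝ≥0∞}
    (hf : ∀ i, Measurable (f i)) :
    ∫⁻ x, ∏ i, f i (x i) ∂(Measure.pi μ) = ∏ i, ∫⁻ x, f i x ∂(μ i) := by
  induction n with
  | zero => simp
  | succ n ih =>
    rw [lintegral_pi_fin_succ μ (by fun_prop), Fin.prod_univ_succ]
    simp only [Fin.prod_univ_succ, Fin.cons_zero, Fin.cons_succ]
    rw [← ih (fun i ↦ μ i.succ) (fun i ↦ hf i.succ), ← lintegral_mul_const _ (hf 0)]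
    exact lintegral_congr fun a ↦ lintegral_const_mul _ (by fun_prop)

theorem lintegral_pow_eq_lintegral_pi {α : Type*} [MeasurableSpace α] (μ : Measure α)
    [SigmaFinite μ] {f : α → ℝ≥0∞} (hf : Measurable f) (p : ℕ) :
    (∫⁻ x, f x ∂μ) ^ p = ∫⁻ x : Fin p → α, ∏ i, f (x i) ∂(Measure.pi fun _ ↦ μ) := by
  rw [lintegral_fin_prod_eq_prod (fun _ ↦ μ) (fun _ ↦ hf)]
  simp

theorem lintegral_pi_comp_perm {ι α : Type*} [Fintype ι] [MeasurableSpace α] (μ : Measure α)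
    [SigmaFinite μ] (σ : Equiv.Perm ι) {f : (ι → α) → ℝ≥0∞} (hf : Measurable f) :
    ∫⁻ x, f (x ∘ σ) ∂(Measure.pi fun _ ↦ μ) = ∫⁻ x, f x ∂(Measure.pi fun _ ↦ μ) := by
  have := (measurePreserving_piCongrLeft (α := fun _ : ι ↦ α) (fun _ ↦ μ) σ.symm).lintegral_comp hf
  rw [← this]
  congr! with x
  ext i
  simp [MeasurableEquiv.piCongrLeft, Equiv.piCongrLeft, Equiv.piCongrLeft']

/-- A product of functions of successive differences integrates to a power. -/
theorem lintegral_prod_differences {ψ : ℝ → ℝ≥0∞} (hψ : Measurable ψ) (p : ℕ) (a : ℝ) :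
    ∫⁻ s : Fin p → ℝ, ∏ k : Fin p, ψ (s k - (Fin.cons a s : Fin (p + 1) → ℝ) k.castSucc)
      ∂(Measure.pi fun _ ↦ volume) = (∫⁻ u, ψ u) ^ p := by
  have hm : ∀ (q : ℕ) (b : ℝ), Measurable fun s : Fin q → ℝ ↦
      ∏ k : Fin q, ψ (s k - (Fin.cons b s : Fin (q + 1) → ℝ) k.castSucc) := by
    intro q b
    refine Finset.measurable_prod _ fun k _ ↦ hψ.comp ((measurable_pi_apply k).sub ?_)
    cases q with
    | zero => exact k.elim0
    | succ q =>
      induction k using Fin.cases with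
      | zero => simp
      | succ j => exact measurable_pi_apply _
  induction p generalizing a with
  | zero => simp
  | succ p ih =>
    rw [lintegral_pi_fin_succ _ (hm _ _)]
    simp only [Fin.prod_univ_succ, Fin.cons_zero, Fin.cons_succ, Fin.castSucc_zero,
      ← Fin.succ_castSucc]
    simp_rw [lintegral_const_mul _ (hm p _), ih]
    rw [lintegral_mul_const _ (by fun_prop), lintegral_sub_right_eq_self, pow_succ, mul_comm]

/-- **Cauchy–Schwarz inequality** for `ℝ≥0∞`-valued functions, with bounds on the squares. -/
theorem lintegral_mul_le_of_lintegral_sq_le {α : Type*} [MeasurableSpace α] {μ : Measure α}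
    {f g : α → ℝ≥0∞} (hf : AEMeasurable f μ) (hg : AEMeasurable g μ) {a b : ℝ≥0∞}
    (ha : ∫⁻ x, f x ^ 2 ∂μ ≤ a) (hb : ∫⁻ x, g x ^ 2 ∂μ ≤ b) :
    ∫⁻ x, f x * g x ∂μ ≤ a ^ (1 / 2 : ℝ) * b ^ (1 / 2 : ℝ) := by
  refine (ENNReal.lintegral_mul_le_Lp_mul_Lq μ Real.HolderConjugate.two_two hf hg).trans ?_
  simp only [ENNReal.rpow_two]
  gcongr

theorem sum_sq_le_card_mul_sum_sq_ennreal {ι : Type*} [Fintype ι] (f : ι → ℝ≥0∞) :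
    (∑ i, f i) ^ 2 ≤ Fintype.card ι * ∑ i, f i ^ 2 := by
  have h := ENNReal.inner_le_Lp_mul_Lq Finset.univ (fun _ : ι ↦ (1 : ℝ≥0∞)) f
    Real.HolderConjugate.two_two
  simp only [one_mul, ENNReal.rpow_two, one_pow, Finset.sum_const, Finset.card_univ,
    nsmul_eq_mul, mul_one] at h
  calc (∑ i, f i) ^ 2 ≤ (((Fintype.card ι : ℝ≥0∞)) ^ (1 / 2 : ℝ) *
        (∑ i, f i ^ 2) ^ (1 / 2 : ℝ)) ^ 2 := by gcongr
    _ = _ := by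
      rw [mul_pow, ← ENNReal.rpow_natCast, ← ENNReal.rpow_natCast, ← ENNReal.rpow_mul,
        ← ENNReal.rpow_mul]
      norm_num

end MeasureTheory

/-! ### Path integrals along independent increments -/

theorem Fin.measurable_partialSum {E : Type*} [AddMonoid E] [MeasurableSpace E]
    [MeasurableAdd₂ E] {n : ℕ} (k : Fin (n + 1)) :
    Measurable fun ξ : Fin n → E ↦ Fin.partialSum ξ k := by
  induction k using Fin.induction with
  | zero => simp
  | succ k ih =>
    simp only [Fin.partialSum_succ]
    exact ih.add (measurable_pi_apply _)

namespace SRW4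

variable {E Z : Type*} [AddCommGroup E] [MeasurableSpace E] [MeasurableAdd₂ E]
  [MeasurableSpace Z]

/-- The expectation of `∏ h (x k) (z k)` along the path `x` started at `a` with independent
increments of laws `μ k`. -/
noncomputable def pathIntegral (h : E → Z → ℝ≥0∞) {n : ℕ} (μ : Fin n → Measure E) (a : E) (z : Fin n → Z) :
    ℝ≥0∞ :=
  ∫⁻ ξ, ∏ k : Fin n, h (a + Fin.partialSum ξ k.succ) (z k) ∂(Measure.pi μ)

theorem measurable_path_integrand {h : E → Z → ℝ≥0∞} (hh : Measurable (Function.uncurry h))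
    (n : ℕ) : Measurable fun q : (E × (Fin n → Z)) × (Fin n → E) ↦
      ∏ k : Fin n, h (q.1.1 + Fin.partialSum q.2 k.succ) (q.1.2 k) := by
  refine Finset.measurable_prod _ fun k _ ↦ ?_
  have h1 : Measurable fun q : (E × (Fin n → Z)) × (Fin n → E) ↦
      q.1.1 + Fin.partialSum q.2 k.succ :=
    (measurable_fst.comp measurable_fst).add
      ((Fin.measurable_partialSum _).comp measurable_snd)
  exact hh.comp (h1.prodMk ((measurable_pi_apply k).comp (measurable_snd.comp measurable_fst)))

theorem measurable_pathIntegral {h : E → Z → ℝ≥0∞} (hh : Measurable (Function.uncurry h))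
    {n : ℕ} (μ : Fin n → Measure E) [∀ k, SigmaFinite (μ k)] :
    Measurable (Function.uncurry (pathIntegral h μ)) :=
  (measurable_path_integrand hh n).lintegral_prod_right'

theorem pathIntegral_cons {h : E → Z → ℝ≥0∞} (hh : Measurable (Function.uncurry h))
    {n : ℕ} (μ : Fin (n + 1) → Measure E) [∀ k, SigmaFinite (μ k)] (a : E) (w : Z)
    (z : Fin n → Z) :
    pathIntegral h μ a (Fin.cons w z : Fin (n + 1) → Z) =
      ∫⁻ ξ, h (a + ξ) w * pathIntegral h (fun k ↦ μ k.succ) (a + ξ) z ∂(μ 0) := by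
  unfold pathIntegral
  rw [lintegral_pi_fin_succ μ]
  · refine lintegral_congr fun ξ ↦ ?_
    simp only [Fin.prod_univ_succ, Fin.cons_zero, Fin.cons_succ]
    simp only [Fin.partialSum_succ', Fin.partialSum_zero, Fin.cons_zero, Fin.tail_cons, add_zero,
      ← add_assoc]
    rw [lintegral_const_mul]
    exact (measurable_path_integrand hh n).comp
      (f := fun η : Fin n → E ↦ ((a + ξ, z), η)) (by fun_prop)
  · exact (measurable_path_integrand hh (n + 1)).comp
      (f := fun η : Fin (n + 1) → E ↦ ((a, (Fin.cons w z : Fin (n + 1) → Z)), η)) (by fun_prop)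

theorem lintegral_pathIntegral_mul_le {h : E → Z → ℝ≥0∞} (hh : Measurable (Function.uncurry h))
    (m : Measure Z) [SigmaFinite m] {n : ℕ} (μ ν : Fin n → Measure E) [∀ k, SigmaFinite (μ k)]
    [∀ k, SigmaFinite (ν k)] (M : Fin n → ℝ≥0∞)
    (hM : ∀ k x y, ∫⁻ z, (∫⁻ ξ, h (x + ξ) z ∂(μ k)) * (∫⁻ ξ, h (y + ξ) z ∂(ν k)) ∂m ≤ M k)
    (a b : E) :
    ∫⁻ z, pathIntegral h μ a z * pathIntegral h ν b z ∂(Measure.pi fun _ ↦ m) ≤ ∏ k, M k := by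
  induction n generalizing a b with
  | zero => simp [pathIntegral]
  | succ n ih =>
    have hμ := measurable_pathIntegral hh fun k ↦ μ k.succ
    have hν := measurable_pathIntegral hh fun k ↦ ν k.succ
    have hμ' := measurable_pathIntegral hh μ
    have hν' := measurable_pathIntegral hh ν
    rw [lintegral_pi_fin_succ]
    swap
    · exact (hμ'.comp (measurable_const.prodMk measurable_id)).mul
        (hν'.comp (measurable_const.prodMk measurable_id))
    simp only [pathIntegral_cons hh]
    have key : ∀ w, ∫⁻ z : Fin n → Z, (∫⁻ ξ, h (a + ξ) w * pathIntegral h (fun k ↦ μ k.succ)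
        (a + ξ) z ∂(μ 0)) * (∫⁻ η, h (b + η) w * pathIntegral h (fun k ↦ ν k.succ) (b + η) z
        ∂(ν 0)) ∂(Measure.pi fun _ ↦ m) ≤
        (∏ k : Fin n, M k.succ) * ((∫⁻ ξ, h (a + ξ) w ∂(μ 0)) * (∫⁻ η, h (b + η) w ∂(ν 0))) := by
      intro w
      have e1 : ∀ (c : E), Measurable fun ξ ↦ h (c + ξ) w := fun c ↦
        hh.comp ((measurable_const_add c).prodMk measurable_const)
      have e2 : ∀ (c : E), Measurable fun q : (Fin n → Z) × E ↦
          pathIntegral h (fun k ↦ μ k.succ) (c + q.2) q.1 := fun c ↦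
        hμ.comp (((measurable_const_add c).comp measurable_snd).prodMk measurable_fst)
      have e3 : ∀ (c : E), Measurable fun q : (Fin n → Z) × E ↦
          pathIntegral h (fun k ↦ ν k.succ) (c + q.2) q.1 := fun c ↦
        hν.comp (((measurable_const_add c).comp measurable_snd).prodMk measurable_fst)
      have e2' : Measurable fun q : (Fin n → Z) × E ↦
          h (a + q.2) w * pathIntegral h (fun k ↦ μ k.succ) (a + q.2) q.1 :=
        ((e1 a).comp measurable_snd).mul (e2 a)
      have e3' : Measurable fun q : (Fin n → Z) × E ↦
          h (b + q.2) w * pathIntegral h (fun k ↦ ν k.succ) (b + q.2) q.1 :=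
        ((e1 b).comp measurable_snd).mul (e3 b)
      calc _ = ∫⁻ z : Fin n → Z, (∫⁻ q : E × E, (h (a + q.1) w * pathIntegral h
              (fun k ↦ μ k.succ) (a + q.1) z) * (h (b + q.2) w * pathIntegral h
              (fun k ↦ ν k.succ) (b + q.2) z) ∂((μ 0).prod (ν 0))) ∂(Measure.pi fun _ ↦ m) := by
            refine lintegral_congr fun z ↦ ?_
            rw [lintegral_prod_mul (f := fun ξ ↦ h (a + ξ) w * pathIntegral h
              (fun k ↦ μ k.succ) (a + ξ) z) (g := fun η ↦ h (b + η) w * pathIntegral h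
              (fun k ↦ ν k.succ) (b + η) z)]
            · exact (e2'.comp (measurable_const.prodMk measurable_id)).aemeasurable
            · exact (e3'.comp (measurable_const.prodMk measurable_id)).aemeasurable
        _ = ∫⁻ q : E × E, ∫⁻ z : Fin n → Z, (h (a + q.1) w * pathIntegral h
              (fun k ↦ μ k.succ) (a + q.1) z) * (h (b + q.2) w * pathIntegral h
              (fun k ↦ ν k.succ) (b + q.2) z) ∂(Measure.pi fun _ ↦ m) ∂((μ 0).prod (ν 0)) := by
            refine lintegral_lintegral_swap (Measurable.aemeasurable ?_)
            exact (e2'.comp (measurable_fst.prodMk (measurable_fst.comp measurable_snd))).mul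
              (e3'.comp (measurable_fst.prodMk (measurable_snd.comp measurable_snd)))
        _ ≤ ∫⁻ q : E × E, (∏ k : Fin n, M k.succ) * (h (a + q.1) w * h (b + q.2) w)
              ∂((μ 0).prod (ν 0)) := by
            refine lintegral_mono fun q ↦ ?_
            simp_rw [mul_mul_mul_comm (h (a + q.1) w)]
            rw [lintegral_const_mul, mul_comm]
            · gcongr
              exact ih (fun k ↦ μ k.succ) (fun k ↦ ν k.succ) (fun k ↦ M k.succ)
                (fun k ↦ hM k.succ) _ _
            · exact (hμ.comp (measurable_const.prodMk measurable_id)).mul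
                (hν.comp (measurable_const.prodMk measurable_id))
        _ = _ := by
            rw [lintegral_const_mul, lintegral_prod_mul (e1 a).aemeasurable (e1 b).aemeasurable]
            exact ((e1 a).comp measurable_fst).mul ((e1 b).comp measurable_snd)
    refine (lintegral_mono key).trans ?_
    have e4 : ∀ (ρ : Measure E) [SigmaFinite ρ] (c : E), Measurable fun w ↦ ∫⁻ ξ, h (c + ξ) w ∂ρ :=
      fun ρ _ c ↦ Measurable.lintegral_prod_right' (f := fun q : Z × E ↦ h (c + q.2) q.1)
        (hh.comp (((measurable_const_add c).comp measurable_snd).prodMk measurable_fst))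
    rw [lintegral_const_mul _ (by exact (e4 _ a).mul (e4 _ b)), Fin.prod_univ_succ, mul_comm]
    gcongr
    exact hM 0 a b

end SRW4

/-! ### Symmetrization -/

theorem measurableSet_setOf_monotone_fin (p : ℕ) : MeasurableSet {s : Fin p → ℝ | Monotone s} := by
  simp only [Monotone, Set.ofPred_forall]
  refine MeasurableSet.iInter fun i ↦ MeasurableSet.iInter fun j ↦ MeasurableSet.iInter fun _ ↦ ?_
  exact measurableSet_le (measurable_pi_apply i) (measurable_pi_apply j)

/-- The square of the integral of a symmetric function is controlled by the integral over ordered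
tuples. -/
theorem MeasureTheory.lintegral_sq_le_of_symmetric {Z : Type*} [MeasurableSpace Z] {p : ℕ}
    (ρ : Measure ℝ) [SigmaFinite ρ] (m : Measure Z) [SigmaFinite m]
    {Φ : (Fin p → ℝ) → (Fin p → Z) → ℝ≥0∞} (hΦ : Measurable (Function.uncurry Φ))
    (hsymm : ∀ (σ : Equiv.Perm (Fin p)) s z, Φ (s ∘ σ) (z ∘ σ) = Φ s z) :
    ∫⁻ z, (∫⁻ s, Φ s z ∂(Measure.pi fun _ ↦ ρ)) ^ 2 ∂(Measure.pi fun _ ↦ m) ≤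
      (p.factorial : ℝ≥0∞) ^ 2 * ∫⁻ z, (∫⁻ s, {s | Monotone s}.indicator (fun s ↦ Φ s z) s
        ∂(Measure.pi fun _ ↦ ρ)) ^ 2 ∂(Measure.pi fun _ ↦ m) := by
  have hM := measurableSet_setOf_monotone_fin p
  set F₀ : (Fin p → Z) → ℝ≥0∞ := fun z ↦
    ∫⁻ s, {s | Monotone s}.indicator (fun s ↦ Φ s z) s ∂(Measure.pi fun _ ↦ ρ) with hF₀
  have hΦz : ∀ z, Measurable fun s ↦ Φ s z := fun z ↦
    hΦ.comp (measurable_id.prodMk measurable_const)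
  have hF₀m : Measurable F₀ := by
    have : Measurable fun q : (Fin p → Z) × (Fin p → ℝ) ↦
        {s | Monotone s}.indicator (fun s ↦ Φ s q.1) q.2 :=
      Measurable.indicator (s := {q : (Fin p → Z) × (Fin p → ℝ) | Monotone q.2})
        (hΦ.comp measurable_swap) (measurable_snd hM)
    exact this.lintegral_prod_right'
  have hcomp : ∀ σ : Equiv.Perm (Fin p), Measurable fun z : Fin p → Z ↦ z ∘ σ := fun σ ↦
    measurable_pi_lambda _ fun i ↦ measurable_pi_apply _
  have hcompR : ∀ σ : Equiv.Perm (Fin p), Measurable fun z : Fin p → ℝ ↦ z ∘ σ := fun σ ↦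
    measurable_pi_lambda _ fun i ↦ measurable_pi_apply _
  have hle : ∀ z, ∫⁻ s, Φ s z ∂(Measure.pi fun _ ↦ ρ) ≤ ∑ σ : Equiv.Perm (Fin p), F₀ (z ∘ σ) := by
    intro z
    calc ∫⁻ s, Φ s z ∂(Measure.pi fun _ ↦ ρ)
        ≤ ∫⁻ s, ∑ σ : Equiv.Perm (Fin p),
          {s | Monotone s}.indicator (fun s ↦ Φ s (z ∘ σ)) (s ∘ σ) ∂(Measure.pi fun _ ↦ ρ) := by
          refine lintegral_mono fun s ↦ ?_
          refine le_trans (le_of_eq ?_) (Finset.single_le_sum (fun _ _ ↦ zero_le)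
            (Finset.mem_univ (Tuple.sort s)))
          rw [Set.indicator_of_mem (show s ∘ Tuple.sort s ∈ {s | Monotone s} from
            Tuple.monotone_sort s), hsymm]
      _ = ∑ σ : Equiv.Perm (Fin p), ∫⁻ s,
          {s | Monotone s}.indicator (fun s ↦ Φ s (z ∘ σ)) (s ∘ σ) ∂(Measure.pi fun _ ↦ ρ) :=
          lintegral_finsetSum _ fun σ _ ↦ ((hΦz _).indicator hM).comp (hcompR σ)
      _ = _ := Finset.sum_congr rfl fun σ _ ↦
          lintegral_pi_comp_perm ρ σ ((hΦz _).indicator hM)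
  calc ∫⁻ z, (∫⁻ s, Φ s z ∂(Measure.pi fun _ ↦ ρ)) ^ 2 ∂(Measure.pi fun _ ↦ m)
      ≤ ∫⁻ z, (p.factorial : ℝ≥0∞) * ∑ σ : Equiv.Perm (Fin p), F₀ (z ∘ σ) ^ 2
        ∂(Measure.pi fun _ ↦ m) := by
        refine lintegral_mono fun z ↦ (pow_le_pow_left' (hle z) 2).trans ?_
        refine (sum_sq_le_card_mul_sum_sq_ennreal _).trans (le_of_eq ?_)
        rw [Fintype.card_perm, Fintype.card_fin]
    _ = (p.factorial : ℝ≥0∞) * ∑ σ : Equiv.Perm (Fin p), ∫⁻ z, F₀ (z ∘ σ) ^ 2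
        ∂(Measure.pi fun _ ↦ m) := by
        have hm : ∀ σ : Equiv.Perm (Fin p), Measurable fun z ↦ F₀ (z ∘ σ) ^ 2 := fun σ ↦
          (hF₀m.comp (hcomp σ)).pow_const 2
        rw [lintegral_const_mul _ (Finset.measurable_sum _ fun σ _ ↦ hm σ),
          lintegral_finsetSum _ fun σ _ ↦ hm σ]
    _ = (p.factorial : ℝ≥0∞) * ∑ _σ : Equiv.Perm (Fin p), ∫⁻ z, F₀ z ^ 2
        ∂(Measure.pi fun _ ↦ m) := by
        congr 1
        exact Finset.sum_congr rfl fun σ _ ↦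
          lintegral_pi_comp_perm m σ (f := fun z ↦ F₀ z ^ 2) (hF₀m.pow_const 2)
    _ = _ := by
        rw [Finset.sum_const, Finset.card_univ, Fintype.card_perm, Fintype.card_fin, nsmul_eq_mul,
          sq, mul_assoc]

/-! ### The simplex integral -/

theorem Fin.sum_succ_sub_castSucc {p : ℕ} (t : Fin (p + 1) → ℝ) :
    ∑ k : Fin p, (t k.succ - t k.castSucc) = t (Fin.last p) - t 0 := by
  have h1 := Fin.sum_univ_succ t
  have h2 := Fin.sum_univ_castSucc t
  rw [Finset.sum_sub_distrib]
  linarith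

theorem Fin.monotone_cons {p : ℕ} {a : ℝ} {s : Fin p → ℝ} (hs : Monotone s) (ha : ∀ k, a ≤ s k) :
    Monotone (Fin.cons a s : Fin (p + 1) → ℝ) := by
  intro i j hij
  induction i using Fin.cases with
  | zero =>
    induction j using Fin.cases with
    | zero => simp
    | succ j => simpa using ha j
  | succ i =>
    induction j using Fin.cases with
    | zero => simp at hij
    | succ j => simpa using hs (by simpa using hij)

theorem lintegral_rpow_neg_half_mul_exp {c lam : ℝ} (hc : 0 < c) (hlam : 0 < lam) :
    ∫⁻ u in Set.Ioi (0 : ℝ), (ENNReal.ofReal c / ENNReal.ofReal u) ^ (1 / 2 : ℝ) *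
      ENNReal.ofReal (Real.exp (-(lam * u))) = ENNReal.ofReal (√(c * Real.pi / lam)) := by
  have h : ∀ u ∈ Set.Ioi (0 : ℝ), (ENNReal.ofReal c / ENNReal.ofReal u) ^ (1 / 2 : ℝ) *
      ENNReal.ofReal (Real.exp (-(lam * u))) =
      ENNReal.ofReal (√c * (u ^ ((1 / 2 : ℝ) - 1) * Real.exp (-(lam * u)))) := by
    intro u hu
    have hu : 0 < u := hu
    rw [← ENNReal.ofReal_div_of_pos hu, ENNReal.ofReal_rpow_of_pos (by positivity),
      ← ENNReal.ofReal_mul (by positivity), Real.div_rpow hc.le hu.le, ← Real.sqrt_eq_rpow c]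
    congr 1
    rw [show (1 / 2 : ℝ) - 1 = -(1 / 2) by norm_num, Real.rpow_neg hu.le]
    ring
  rw [setLIntegral_congr_fun measurableSet_Ioi h, ← ofReal_integral_eq_lintegral_ofReal]
  · rw [integral_const_mul, Real.integral_rpow_mul_exp_neg_mul_Ioi (by norm_num) hlam,
      Real.Gamma_one_half_eq, ← Real.sqrt_eq_rpow, ← Real.sqrt_mul (by positivity),
      ← Real.sqrt_mul (by positivity)]
    congr 2
    ring
  · refine Integrable.const_mul ?_ _
    refine Integrable.of_integral_ne_zero ?_
    rw [Real.integral_rpow_mul_exp_neg_mul_Ioi (by norm_num) hlam, Real.Gamma_one_half_eq]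
    positivity
  · refine (ae_restrict_iff' measurableSet_Ioi).2 (ae_of_all _ fun u hu ↦ ?_)
    have hu : 0 < u := hu
    positivity

theorem lintegral_simplex_le {c : ℝ} (hc : 0 < c) {p : ℕ} (hp : p ≠ 0) :
    ∫⁻ s : Fin p → ℝ, {s | Monotone s}.indicator (fun s ↦ ∏ k : Fin p,
      (ENNReal.ofReal c / ENNReal.ofReal (s k - (Fin.cons 0 s : Fin (p + 1) → ℝ) k.castSucc)) ^
        (1 / 2 : ℝ)) s ∂(Measure.pi fun _ ↦ volume.restrict (Set.Icc 0 1)) ≤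
      ENNReal.ofReal (Real.exp p) * ENNReal.ofReal (√(c * Real.pi / p)) ^ p := by
  have hp' : (0 : ℝ) < p := by positivity
  set ψ : ℝ → ℝ≥0∞ := (Set.Ici 0).indicator fun u ↦
    (ENNReal.ofReal c / ENNReal.ofReal u) ^ (1 / 2 : ℝ) * ENNReal.ofReal (Real.exp (-(p * u)))
    with hψ
  have hψm : Measurable ψ := by
    refine Measurable.indicator ?_ measurableSet_Ici
    fun_prop
  have hψi : ∫⁻ u, ψ u = ENNReal.ofReal (√(c * Real.pi / p)) := by
    rw [hψ, lintegral_indicator measurableSet_Ici, setLIntegral_congr Ioi_ae_eq_Ici.symm]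
    exact lintegral_rpow_neg_half_mul_exp hc hp'
  rw [← hψi, ← lintegral_prod_differences hψm p 0, ← Measure.restrict_pi_pi,
    ← lintegral_const_mul' _ _ ENNReal.ofReal_ne_top]
  rw [← lintegral_indicator (MeasurableSet.univ_pi fun _ ↦ measurableSet_Icc)]
  refine lintegral_mono fun s ↦ ?_
  refine Set.indicator_apply_le' (fun hs1 ↦ ?_) (fun _ ↦ zero_le)
  refine Set.indicator_apply_le' (fun hs2 ↦ ?_) (fun _ ↦ zero_le)
  have h01 : ∀ k, s k ∈ Set.Icc (0 : ℝ) 1 := fun k ↦ hs1 k trivial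
  set t : Fin (p + 1) → ℝ := Fin.cons 0 s with ht
  have htm : Monotone t := Fin.monotone_cons hs2 fun k ↦ (h01 k).1
  have hnn : ∀ k : Fin p, 0 ≤ s k - t k.castSucc := fun k ↦ by
    have := htm k.castSucc_le_succ
    simpa [ht] using this
  have hsum : ∑ k : Fin p, (s k - t k.castSucc) ≤ 1 := by
    have h := Fin.sum_succ_sub_castSucc t
    have h1 : ∀ k : Fin p, t k.succ = s k := fun k ↦ by simp [ht]
    simp only [h1] at h
    rw [h]
    have : t (Fin.last p) ≤ 1 := by
      obtain ⟨q, rfl⟩ := Nat.exists_eq_succ_of_ne_zero hp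
      exact (h01 (Fin.last q)).2
    simpa [ht] using this
  have hexp : ∏ k : Fin p, ψ (s k - t k.castSucc) = (∏ k : Fin p,
      (ENNReal.ofReal c / ENNReal.ofReal (s k - t k.castSucc)) ^ (1 / 2 : ℝ)) *
      ENNReal.ofReal (Real.exp (-(p * ∑ k : Fin p, (s k - t k.castSucc)))) := by
    rw [Finset.mul_sum, ← Finset.sum_neg_distrib, Real.exp_sum,
      ENNReal.ofReal_prod_of_nonneg fun _ _ ↦ by positivity, ← Finset.prod_mul_distrib]
    refine Finset.prod_congr rfl fun k _ ↦ ?_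
    rw [hψ, Set.indicator_of_mem (Set.mem_Ici.2 (hnn k))]
  rw [hexp, mul_left_comm, ← ENNReal.ofReal_mul (by positivity), ← Real.exp_add]
  refine le_mul_of_one_le_right' ?_
  rw [ENNReal.one_le_ofReal, Real.one_le_exp_iff]
  nlinarith

/-! ### Moments of energies of processes with independent increments -/

namespace SRW4

variable {Ω E Z : Type*} [MeasurableSpace Ω] {P : Measure Ω} [AddCommGroup E] [MeasurableSpace E]
  [MeasurableAdd₂ E] [MeasurableSub₂ E] [MeasurableSpace Z]

theorem lintegral_prod_eq_pathIntegral [IsProbabilityMeasure P] {X : ℝ → Ω → E}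
    (hX : ∀ t, Measurable (X t)) (hind : HasIndepIncrements X P) (h0 : ∀ᵐ ω ∂P, X 0 ω = 0)
    {h : E → Z → ℝ≥0∞} (hh : Measurable (Function.uncurry h)) {p : ℕ} {s : Fin p → ℝ}
    (hs : Monotone s) (hs0 : ∀ k, 0 ≤ s k) (z : Fin p → Z) :
    ∫⁻ ω, ∏ k, h (X (s k) ω) (z k) ∂P = pathIntegral h (fun k ↦
      P.map fun ω ↦ X (s k) ω - X ((Fin.cons 0 s : Fin (p + 1) → ℝ) k.castSucc) ω) 0 z := by
  set t : Fin (p + 1) → ℝ := Fin.cons 0 s with ht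
  have hlaw := iIndepFun.hasLaw_pi (fun k : Fin p ↦
    (⟨((hX (t k.succ)).sub (hX (t k.castSucc))).aemeasurable, rfl⟩ :
      HasLaw (fun ω ↦ X (t k.succ) ω - X (t k.castSucc) ω)
        (P.map fun ω ↦ X (t k.succ) ω - X (t k.castSucc) ω) P))
    (hind p t (Fin.monotone_cons hs hs0))
  have h1 : ∀ k : Fin p, t k.succ = s k := fun k ↦ by simp [ht]
  simp only [h1] at hlaw
  have hm : Measurable fun ξ : Fin p → E ↦
      ∏ k : Fin p, h (0 + Fin.partialSum ξ k.succ) (z k) :=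
    (measurable_path_integrand hh p).comp (f := fun ξ : Fin p → E ↦ (((0 : E), z), ξ)) (by fun_prop)
  unfold pathIntegral
  rw [← hlaw.lintegral_comp hm.aemeasurable]
  refine lintegral_congr_ae ?_
  filter_upwards [h0] with ω hω
  refine Finset.prod_congr rfl fun k _ ↦ ?_
  congr 1
  have hp := congrFun (Fin.partialSum_left_neg fun i ↦ X (t i) ω) k.succ
  have ht0 : t 0 = 0 := by simp [ht]
  simp only [Pi.vadd_apply, vadd_eq_add, ht0, hω, h1] at hp
  rw [← hp]
  congr 2
  ext i
  abel

theorem factorial_sq_mul_le {c : ℝ} (hc : 0 < c) {p : ℕ} (hp : p ≠ 0) :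
    (p.factorial : ℝ) ^ 2 * (Real.exp p * √(c * Real.pi / p) ^ p) ^ 2 ≤
      (c * Real.pi * Real.exp 2) ^ p * p.factorial := by
  have hp' : (0 : ℝ) < p := by positivity
  have h1 : (Real.exp p * √(c * Real.pi / p) ^ p) ^ 2 =
      (c * Real.pi * Real.exp 2) ^ p / (p : ℝ) ^ p := by
    rw [mul_pow, ← pow_mul, mul_comm p 2, pow_mul, Real.sq_sqrt (by positivity), div_pow,
      mul_pow _ (Real.exp 2), ← Real.exp_nat_mul, ← Real.exp_nat_mul]
    push_cast
    rw [mul_comm (2 : ℝ)]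
    ring
  have h2 : (p.factorial : ℝ) ≤ (p : ℝ) ^ p := by exact_mod_cast p.factorial_le_pow
  rw [h1, mul_div_assoc', div_le_iff₀ (by positivity)]
  nlinarith [mul_le_mul_of_nonneg_left h2 (by positivity :
    0 ≤ (p.factorial : ℝ) * (c * Real.pi * Real.exp 2) ^ p)]

theorem measurable_process_integrand {Ω E Z : Type*} [MeasurableSpace Ω] [MeasurableSpace E]
    [MeasurableSpace Z] {X : ℝ → Ω → E} (hX : Measurable (Function.uncurry X))
    {h : E → Z → ℝ≥0∞} (hh : Measurable (Function.uncurry h)) (p : ℕ) :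
    Measurable fun q : ((Fin p → ℝ) × (Fin p → Z)) × Ω ↦
      ∏ k, h (X (q.1.1 k) q.2) (q.1.2 k) := by
  refine Finset.measurable_prod _ fun k _ ↦ ?_
  have h1 : Measurable fun q : ((Fin p → ℝ) × (Fin p → Z)) × Ω ↦ X (q.1.1 k) q.2 :=
    hX.comp (f := fun q : ((Fin p → ℝ) × (Fin p → Z)) × Ω ↦ (q.1.1 k, q.2)) (by fun_prop)
  exact hh.comp (h1.prodMk ((measurable_pi_apply k).comp (measurable_snd.comp measurable_fst)))

theorem lintegral_sq_process_le [IsProbabilityMeasure P] {X : ℝ → Ω → E}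
    (hX : Measurable (Function.uncurry X)) (hind : HasIndepIncrements X P)
    (h0 : ∀ᵐ ω ∂P, X 0 ω = 0) {h : E → Z → ℝ≥0∞} (hh : Measurable (Function.uncurry h))
    (m : Measure Z) [SigmaFinite m] {c : ℝ} (hc : 0 < c)
    (hbound : ∀ s t, 0 ≤ s → s ≤ t → ∀ x,
      ∫⁻ z, (∫⁻ ω, h (x + (X t ω - X s ω)) z ∂P) ^ 2 ∂m ≤
        ENNReal.ofReal c / ENNReal.ofReal (t - s)) {p : ℕ} (hp : p ≠ 0) :
    ∫⁻ z, (∫⁻ s, ∫⁻ ω, ∏ k, h (X (s k) ω) (z k) ∂P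
      ∂(Measure.pi fun _ : Fin p ↦ volume.restrict (Set.Icc 0 1))) ^ 2
      ∂(Measure.pi fun _ : Fin p ↦ m) ≤
      ENNReal.ofReal ((c * Real.pi * Real.exp 2) ^ p * p.factorial) := by
  have hXt : ∀ t, Measurable (X t) := fun t ↦ hX.comp (measurable_const.prodMk measurable_id)
  have hΦ : Measurable (Function.uncurry fun (s : Fin p → ℝ) (z : Fin p → Z) ↦
      ∫⁻ ω, ∏ k, h (X (s k) ω) (z k) ∂P) :=
    (measurable_process_integrand hX hh p).lintegral_prod_right'
  refine (lintegral_sq_le_of_symmetric _ m hΦ fun σ s z ↦ ?_).trans ?_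
  · refine lintegral_congr fun ω ↦ ?_
    exact Equiv.prod_comp σ fun k ↦ h (X (s k) ω) (z k)
  have hM := measurableSet_setOf_monotone_fin p
  set ρ : Measure (Fin p → ℝ) := Measure.pi fun _ : Fin p ↦ volume.restrict (Set.Icc 0 1) with hρ
  set Ψ : (Fin p → Z) → (Fin p → ℝ) → ℝ≥0∞ := fun z ↦ {s | Monotone s}.indicator
    fun s ↦ ∫⁻ ω, ∏ k, h (X (s k) ω) (z k) ∂P with hΨ
  have hΨm : Measurable (Function.uncurry Ψ) :=
    Measurable.indicator (s := {q : (Fin p → Z) × (Fin p → ℝ) | Monotone q.2})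
      (hΦ.comp measurable_swap) (measurable_snd hM)
  set N : (Fin p → ℝ) → ℝ≥0∞ := {s | Monotone s}.indicator fun s ↦ ∏ k : Fin p,
    (ENNReal.ofReal c / ENNReal.ofReal (s k - (Fin.cons 0 s : Fin (p + 1) → ℝ) k.castSucc)) ^
      (1 / 2 : ℝ) with hN
  have hNm : Measurable N := by
    refine Measurable.indicator (Finset.measurable_prod _ fun k _ ↦ ?_) hM
    have hk : Measurable fun s : Fin p → ℝ ↦ (Fin.cons 0 s : Fin (p + 1) → ℝ) k.castSucc := by
      cases p with
      | zero => exact k.elim0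
      | succ q =>
        induction k using Fin.cases with
        | zero => simp
        | succ j => exact measurable_pi_apply _
    fun_prop
  have hpos : ∀ᵐ s ∂ρ, ∀ k, 0 ≤ s k := by
    rw [hρ, ← Measure.restrict_pi_pi]
    refine (ae_restrict_iff' (MeasurableSet.univ_pi fun _ ↦ measurableSet_Icc)).2
      (ae_of_all _ fun s hs k ↦ (hs k trivial).1)
  have hpair : ∀ s t : Fin p → ℝ, (∀ k, 0 ≤ s k) → (∀ k, 0 ≤ t k) →
      ∫⁻ z, Ψ z s * Ψ z t ∂(Measure.pi fun _ : Fin p ↦ m) ≤ N s * N t := by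
    intro s t hs0 ht0
    by_cases hs : Monotone s
    swap
    · simp [hΨ, Set.indicator_of_notMem (show s ∉ {s | Monotone s} from hs)]
    by_cases ht : Monotone t
    swap
    · simp [hΨ, Set.indicator_of_notMem (show t ∉ {s | Monotone s} from ht)]
    have hs' : s ∈ {s : Fin p → ℝ | Monotone s} := hs
    have ht' : t ∈ {s : Fin p → ℝ | Monotone s} := ht
    simp only [hΨ, hN, Set.indicator_of_mem hs', Set.indicator_of_mem ht',
      lintegral_prod_eq_pathIntegral hXt hind h0 hh hs hs0,
      lintegral_prod_eq_pathIntegral hXt hind h0 hh ht ht0]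
    rw [← Finset.prod_mul_distrib]
    have hprob : ∀ a b : ℝ, IsProbabilityMeasure (P.map fun ω ↦ X a ω - X b ω) := fun a b ↦
      Measure.isProbabilityMeasure_map ((hXt a).sub (hXt b)).aemeasurable
    refine lintegral_pathIntegral_mul_le hh m _ _ _ (fun k x y ↦ ?_) 0 0
    have hsq : ∀ (r : Fin p → ℝ), Monotone r → (∀ k, 0 ≤ r k) → ∀ (k : Fin p) (x : E),
        ∫⁻ z, (∫⁻ ξ, h (x + ξ) z ∂(P.map fun ω ↦
          X (r k) ω - X ((Fin.cons 0 r : Fin (p + 1) → ℝ) k.castSucc) ω)) ^ 2 ∂m ≤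
        ENNReal.ofReal c /
          ENNReal.ofReal (r k - (Fin.cons 0 r : Fin (p + 1) → ℝ) k.castSucc) := by
      intro r hr hr0 k x
      have hmono := Fin.monotone_cons hr hr0
      refine le_trans (le_of_eq (lintegral_congr fun z ↦ ?_))
        (hbound ((Fin.cons 0 r : Fin (p + 1) → ℝ) k.castSucc) (r k) ?_ ?_ x)
      · rw [lintegral_map (f := fun ξ ↦ h (x + ξ) z) _ (by exact (hXt _).sub (hXt _))]
        exact hh.comp ((measurable_const_add x).prodMk measurable_const)
      · simpa using hmono (Fin.zero_le k.castSucc)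
      · simpa using hmono k.castSucc_le_succ
    have hmeas : ∀ (ν : Measure E) [SigmaFinite ν] (x : E),
        Measurable fun z ↦ ∫⁻ ξ, h (x + ξ) z ∂ν := fun ν _ x ↦
      Measurable.lintegral_prod_right' (f := fun q : Z × E ↦ h (x + q.2) q.1)
        (hh.comp (((measurable_const_add x).comp measurable_snd).prodMk measurable_fst))
    exact lintegral_mul_le_of_lintegral_sq_le (hmeas _ x).aemeasurable (hmeas _ y).aemeasurable
      (hsq s hs hs0 k x) (hsq t ht ht0 k y)
  have hΨz : ∀ z, Measurable (Ψ z) := fun z ↦ hΨm.comp (measurable_const.prodMk measurable_id)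
  have hmain : ∫⁻ z, (∫⁻ s, Ψ z s ∂ρ) ^ 2 ∂(Measure.pi fun _ : Fin p ↦ m) ≤
      (ENNReal.ofReal (Real.exp p) * ENNReal.ofReal (√(c * Real.pi / p)) ^ p) ^ 2 := by
    calc ∫⁻ z, (∫⁻ s, Ψ z s ∂ρ) ^ 2 ∂(Measure.pi fun _ : Fin p ↦ m)
        = ∫⁻ z, ∫⁻ q, Ψ z q.1 * Ψ z q.2 ∂(ρ.prod ρ) ∂(Measure.pi fun _ : Fin p ↦ m) := by
          refine lintegral_congr fun z ↦ ?_
          rw [sq, lintegral_prod_mul (hΨz z).aemeasurable (hΨz z).aemeasurable]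
      _ = ∫⁻ q, ∫⁻ z, Ψ z q.1 * Ψ z q.2 ∂(Measure.pi fun _ : Fin p ↦ m) ∂(ρ.prod ρ) := by
          refine lintegral_lintegral_swap (Measurable.aemeasurable ?_)
          exact (hΨm.comp (measurable_fst.prodMk (measurable_fst.comp measurable_snd))).mul
            (hΨm.comp (measurable_fst.prodMk (measurable_snd.comp measurable_snd)))
      _ ≤ ∫⁻ q, N q.1 * N q.2 ∂(ρ.prod ρ) := by
          refine lintegral_mono_ae ?_
          filter_upwards [Measure.quasiMeasurePreserving_fst.ae hpos,
            Measure.quasiMeasurePreserving_snd.ae hpos] with q h1 h2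
          exact hpair q.1 q.2 h1 h2
      _ = (∫⁻ s, N s ∂ρ) ^ 2 := by
          rw [sq, lintegral_prod_mul hNm.aemeasurable hNm.aemeasurable]
      _ ≤ _ := by
          gcongr
          exact lintegral_simplex_le hc hp
  calc _ ≤ (p.factorial : ℝ≥0∞) ^ 2 *
        (ENNReal.ofReal (Real.exp p) * ENNReal.ofReal (√(c * Real.pi / p)) ^ p) ^ 2 := by
        gcongr
    _ = ENNReal.ofReal ((p.factorial : ℝ) ^ 2 * (Real.exp p * √(c * Real.pi / p) ^ p) ^ 2) := by
        rw [ENNReal.ofReal_mul (by positivity), ENNReal.ofReal_pow (by positivity),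
          ENNReal.ofReal_pow (by positivity), ENNReal.ofReal_mul (by positivity),
          ENNReal.ofReal_pow (by positivity), ENNReal.ofReal_natCast]
    _ ≤ _ := ENNReal.ofReal_le_ofReal (factorial_sq_mul_le hc hp)

/-- Moment bound for the mutual energy of two independent processes with independent
increments. -/
theorem lintegral_energy_pow_le [IsProbabilityMeasure P] {X X' : ℝ → Ω → E}
    (hX : Measurable (Function.uncurry X)) (hind : HasIndepIncrements X P)
    (h0 : ∀ᵐ ω ∂P, X 0 ω = 0)
    (hX' : Measurable (Function.uncurry X')) (hind' : HasIndepIncrements X' P)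
    (h0' : ∀ᵐ ω ∂P, X' 0 ω = 0)
    (hindep : ∀ (p : ℕ) (s t : Fin p → ℝ),
      IndepFun (fun ω k ↦ X (s k) ω) (fun ω k ↦ X' (t k) ω) P)
    {h : E → Z → ℝ≥0∞} (hh : Measurable (Function.uncurry h))
    (m : Measure Z) [SigmaFinite m] {c : ℝ} (hc : 0 < c)
    (hbound : ∀ s t, 0 ≤ s → s ≤ t → ∀ x,
      ∫⁻ z, (∫⁻ ω, h (x + (X t ω - X s ω)) z ∂P) ^ 2 ∂m ≤
        ENNReal.ofReal c / ENNReal.ofReal (t - s))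
    (hbound' : ∀ s t, 0 ≤ s → s ≤ t → ∀ x,
      ∫⁻ z, (∫⁻ ω, h (x + (X' t ω - X' s ω)) z ∂P) ^ 2 ∂m ≤
        ENNReal.ofReal c / ENNReal.ofReal (t - s))
    {Y : Ω → ℝ≥0∞} (hY : ∀ᵐ ω ∂P, Y ω ≤ ∫⁻ s in Set.Icc (0 : ℝ) 1, ∫⁻ t in Set.Icc (0 : ℝ) 1,
      ∫⁻ z, h (X s ω) z * h (X' t ω) z ∂m) (p : ℕ) :
    ∫⁻ ω, Y ω ^ p ∂P ≤ ENNReal.ofReal ((c * Real.pi * Real.exp 2) ^ p * p.factorial) := by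
  rcases eq_or_ne p 0 with rfl | hp
  · simp
  set ρ : Measure ℝ := volume.restrict (Set.Icc 0 1) with hρ
  have hA : ∀ {W : ℝ → Ω → E}, Measurable (Function.uncurry W) →
      Measurable fun q : (Z × Ω) × ℝ ↦ h (W q.2 q.1.2) q.1.1 := fun hW ↦
    hh.comp ((hW.comp (measurable_snd.prodMk (measurable_snd.comp measurable_fst))).prodMk
      (measurable_fst.comp measurable_fst))
  have hA1 : ∀ {W : ℝ → Ω → E}, Measurable (Function.uncurry W) →
      Measurable fun q : Z × Ω ↦ ∫⁻ s, h (W s q.2) q.1 ∂ρ := fun hW ↦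
    (hA hW).lintegral_prod_right'
  have hAz : ∀ {W : ℝ → Ω → E}, Measurable (Function.uncurry W) → ∀ ω z,
      Measurable fun s ↦ h (W s ω) z := fun hW ω z ↦
    (hA hW).comp (f := fun s ↦ ((z, ω), s)) (by fun_prop)
  have hswap : ∀ ω, ∫⁻ s, ∫⁻ t, ∫⁻ z, h (X s ω) z * h (X' t ω) z ∂m ∂ρ ∂ρ =
      ∫⁻ z, (∫⁻ s, h (X s ω) z ∂ρ) * (∫⁻ t, h (X' t ω) z ∂ρ) ∂m := by
    intro ω
    have e1 : Measurable fun q : (ℝ × ℝ) × Z ↦ h (X q.1.1 ω) q.2 * h (X' q.1.2 ω) q.2 :=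
      ((hA hX).comp (f := fun q : (ℝ × ℝ) × Z ↦ ((q.2, ω), q.1.1)) (by fun_prop)).mul
        ((hA hX').comp (f := fun q : (ℝ × ℝ) × Z ↦ ((q.2, ω), q.1.2)) (by fun_prop))
    calc _ = ∫⁻ q, ∫⁻ z, h (X q.1 ω) z * h (X' q.2 ω) z ∂m ∂(ρ.prod ρ) :=
          (lintegral_prod _ e1.lintegral_prod_right'.aemeasurable).symm
      _ = ∫⁻ z, ∫⁻ q, h (X q.1 ω) z * h (X' q.2 ω) z ∂(ρ.prod ρ) ∂m :=
          lintegral_lintegral_swap e1.aemeasurable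
      _ = _ := lintegral_congr fun z ↦
          lintegral_prod_mul (hAz hX ω z).aemeasurable (hAz hX' ω z).aemeasurable
  set Φ : (ℝ → Ω → E) → (Fin p → Z) → ℝ≥0∞ := fun W z ↦
    ∫⁻ s, ∫⁻ ω, ∏ k, h (W (s k) ω) (z k) ∂P ∂(Measure.pi fun _ : Fin p ↦ ρ) with hΦ
  have hΦm : ∀ {W : ℝ → Ω → E}, Measurable (Function.uncurry W) → Measurable (Φ W) := fun {W} hW ↦
    Measurable.lintegral_prod_right' (f := fun q : (Fin p → Z) × (Fin p → ℝ) ↦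
      ∫⁻ ω, ∏ k, h (W (q.2 k) ω) (q.1 k) ∂P) ((measurable_process_integrand hW hh
        p).lintegral_prod_right'.comp measurable_swap)
  have hpow : ∀ᵐ ω ∂P, Y ω ^ p ≤ ∫⁻ z : Fin p → Z, ∫⁻ q : (Fin p → ℝ) × (Fin p → ℝ),
      (∏ k, h (X (q.1 k) ω) (z k)) * (∏ k, h (X' (q.2 k) ω) (z k))
      ∂((Measure.pi fun _ ↦ ρ).prod (Measure.pi fun _ ↦ ρ)) ∂(Measure.pi fun _ ↦ m) := by
    filter_upwards [hY] with ω hω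
    refine (pow_le_pow_left' hω p).trans (le_of_eq ?_)
    rw [hswap, lintegral_pow_eq_lintegral_pi]
    · refine lintegral_congr fun z ↦ ?_
      rw [lintegral_prod_mul (f := fun s : Fin p → ℝ ↦ ∏ k, h (X (s k) ω) (z k))
        (g := fun s : Fin p → ℝ ↦ ∏ k, h (X' (s k) ω) (z k)), Finset.prod_mul_distrib,
        lintegral_fin_prod_eq_prod (fun _ ↦ ρ) (fun k ↦ hAz hX ω (z k)),
        lintegral_fin_prod_eq_prod (fun _ ↦ ρ) (fun k ↦ hAz hX' ω (z k))]
      · exact (Finset.measurable_prod _ fun k _ ↦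
          (hAz hX ω (z k)).comp (measurable_pi_apply k)).aemeasurable
      · exact (Finset.measurable_prod _ fun k _ ↦
          (hAz hX' ω (z k)).comp (measurable_pi_apply k)).aemeasurable
    · exact ((hA1 hX).comp (measurable_id.prodMk measurable_const)).mul
        ((hA1 hX').comp (measurable_id.prodMk measurable_const))
  have hJ : Measurable fun r : ((Fin p → Z) × ((Fin p → ℝ) × (Fin p → ℝ))) × Ω ↦
      (∏ k, h (X (r.1.2.1 k) r.2) (r.1.1 k)) * (∏ k, h (X' (r.1.2.2 k) r.2) (r.1.1 k)) :=
    ((measurable_process_integrand hX hh p).comp (f := fun r :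
      ((Fin p → Z) × ((Fin p → ℝ) × (Fin p → ℝ))) × Ω ↦ ((r.1.2.1, r.1.1), r.2)) (by fun_prop)).mul
    ((measurable_process_integrand hX' hh p).comp (f := fun r :
      ((Fin p → Z) × ((Fin p → ℝ) × (Fin p → ℝ))) × Ω ↦ ((r.1.2.2, r.1.1), r.2)) (by fun_prop))
  have hfac : ∀ (z : Fin p → Z) (q : (Fin p → ℝ) × (Fin p → ℝ)),
      ∫⁻ ω, (∏ k, h (X (q.1 k) ω) (z k)) * (∏ k, h (X' (q.2 k) ω) (z k)) ∂P =
      (∫⁻ ω, ∏ k, h (X (q.1 k) ω) (z k) ∂P) * ∫⁻ ω, ∏ k, h (X' (q.2 k) ω) (z k) ∂P := by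
    intro z q
    have hg : Measurable fun x : Fin p → E ↦ ∏ k, h (x k) (z k) :=
      Finset.measurable_prod _ fun k _ ↦
        hh.comp (f := fun x : Fin p → E ↦ (x k, z k)) (by fun_prop)
    have hWm : ∀ {W : ℝ → Ω → E}, Measurable (Function.uncurry W) → ∀ s : Fin p → ℝ,
        Measurable fun ω k ↦ W (s k) ω := fun hW s ↦
      measurable_pi_lambda _ fun k ↦ hW.comp (measurable_const.prodMk measurable_id)
    exact lintegral_mul_eq_lintegral_mul_lintegral_of_indepFun
      (hg.comp (hWm hX q.1)) (hg.comp (hWm hX' q.2)) ((hindep p q.1 q.2).comp hg hg)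
  have hFz : ∀ {W : ℝ → Ω → E}, Measurable (Function.uncurry W) → ∀ z : Fin p → Z,
      Measurable fun s : Fin p → ℝ ↦ ∫⁻ ω, ∏ k, h (W (s k) ω) (z k) ∂P := fun hW z ↦
    (measurable_process_integrand hW hh p).lintegral_prod_right'.comp
      (f := fun s ↦ (s, z)) (by fun_prop)
  calc ∫⁻ ω, Y ω ^ p ∂P ≤ ∫⁻ ω, ∫⁻ z : Fin p → Z, ∫⁻ q : (Fin p → ℝ) × (Fin p → ℝ),
        (∏ k, h (X (q.1 k) ω) (z k)) * (∏ k, h (X' (q.2 k) ω) (z k))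
        ∂((Measure.pi fun _ ↦ ρ).prod (Measure.pi fun _ ↦ ρ)) ∂(Measure.pi fun _ ↦ m) ∂P :=
        lintegral_mono_ae hpow
    _ = ∫⁻ z : Fin p → Z, ∫⁻ ω, ∫⁻ q : (Fin p → ℝ) × (Fin p → ℝ),
        (∏ k, h (X (q.1 k) ω) (z k)) * (∏ k, h (X' (q.2 k) ω) (z k))
        ∂((Measure.pi fun _ ↦ ρ).prod (Measure.pi fun _ ↦ ρ)) ∂P ∂(Measure.pi fun _ ↦ m) := by
        refine lintegral_lintegral_swap (Measurable.aemeasurable ?_)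
        exact Measurable.lintegral_prod_right' (f := fun r : (Ω × (Fin p → Z)) ×
          ((Fin p → ℝ) × (Fin p → ℝ)) ↦ (∏ k, h (X (r.2.1 k) r.1.1) (r.1.2 k)) *
            (∏ k, h (X' (r.2.2 k) r.1.1) (r.1.2 k)))
          (hJ.comp (f := fun r : (Ω × (Fin p → Z)) × ((Fin p → ℝ) × (Fin p → ℝ)) ↦
            ((r.1.2, r.2), r.1.1)) (by fun_prop))
    _ = ∫⁻ z : Fin p → Z, ∫⁻ q : (Fin p → ℝ) × (Fin p → ℝ), ∫⁻ ω,
        (∏ k, h (X (q.1 k) ω) (z k)) * (∏ k, h (X' (q.2 k) ω) (z k)) ∂P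
        ∂((Measure.pi fun _ ↦ ρ).prod (Measure.pi fun _ ↦ ρ)) ∂(Measure.pi fun _ ↦ m) := by
        refine lintegral_congr fun z ↦ lintegral_lintegral_swap (Measurable.aemeasurable ?_)
        exact hJ.comp (f := fun r : Ω × ((Fin p → ℝ) × (Fin p → ℝ)) ↦ ((z, r.2), r.1))
          (by fun_prop)
    _ = ∫⁻ z : Fin p → Z, Φ X z * Φ X' z ∂(Measure.pi fun _ ↦ m) := by
        refine lintegral_congr fun z ↦ ?_
        simp only [hfac]
        exact lintegral_prod_mul (hFz hX z).aemeasurable (hFz hX' z).aemeasurable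
    _ ≤ _ := by
        refine (lintegral_mul_le_of_lintegral_sq_le (hΦm hX).aemeasurable (hΦm hX').aemeasurable
          (lintegral_sq_process_le hX hind h0 hh m hc hbound hp)
          (lintegral_sq_process_le hX' hind' h0' hh m hc hbound' hp)).trans (le_of_eq ?_)
        rw [← ENNReal.rpow_add_of_nonneg _ _ (by norm_num) (by norm_num)]
        norm_num

end SRW4

/-! ### Exponential moments -/

namespace SRW4

theorem ereal_exp_mul_le_tsum {c : ℝ} (hc : 0 < c) (z : ℝ≥0∞) :
    EReal.exp ((c : EReal) * (z : EReal)) ≤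
      ∑' p : ℕ, ENNReal.ofReal (c ^ p / p.factorial) * z ^ p := by
  induction z using ENNReal.recTopCoe with
  | top =>
    refine le_trans ?_ (ENNReal.le_tsum 1)
    simp [ENNReal.mul_top, hc]
  | coe z =>
    have h : (c : EReal) * ((z : ℝ≥0∞) : EReal) = ((c * z : ℝ) : EReal) := by
      rw [EReal.coe_mul]
      rfl
    rw [h, EReal.exp_coe, Real.exp_eq_exp_ℝ, NormedSpace.exp_eq_tsum_div,
      ENNReal.ofReal_tsum_of_nonneg (fun _ ↦ by positivity)
        (NormedSpace.expSeries_div_summable (c * z))]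
    refine ENNReal.tsum_le_tsum fun p ↦ le_of_eq ?_
    rw [mul_pow, mul_div_right_comm, ENNReal.ofReal_mul (by positivity),
      ENNReal.ofReal_pow (by positivity), ENNReal.ofReal_coe_nnreal]

theorem ereal_exp_mul_le_one {c : ℝ} (hc : c ≤ 0) (z : ℝ≥0∞) :
    EReal.exp ((c : EReal) * (z : EReal)) ≤ 1 := by
  rw [EReal.exp_le_one_iff]
  exact EReal.mul_nonpos_iff.2 (.inr ⟨by exact_mod_cast hc, EReal.coe_ennreal_nonneg z⟩)

theorem expMoment_le {Ω : Type*} [MeasurableSpace Ω] {P : Measure Ω} [IsProbabilityMeasure P]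
    {Y : Ω → ℝ≥0∞} (hY : AEMeasurable Y P) {C : ℝ} (hC : 0 < C)
    (hmom : ∀ p : ℕ, ∫⁻ ω, Y ω ^ p ∂P ≤ ENNReal.ofReal (C ^ p * p.factorial)) (c : ℝ) :
    expMoment P Y c ≤ 1 + (1 - ENNReal.ofReal (c * C))⁻¹ := by
  unfold expMoment
  rcases le_or_gt c 0 with hc | hc
  · calc _ ≤ ∫⁻ _, 1 ∂P := lintegral_mono fun ω ↦ ereal_exp_mul_le_one hc (Y ω)
      _ = 1 := by simp
      _ ≤ _ := le_self_add
  · calc _ ≤ ∫⁻ ω, ∑' p : ℕ, ENNReal.ofReal (c ^ p / p.factorial) * Y ω ^ p ∂P :=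
          lintegral_mono fun ω ↦ ereal_exp_mul_le_tsum hc (Y ω)
      _ = ∑' p : ℕ, ENNReal.ofReal (c ^ p / p.factorial) * ∫⁻ ω, Y ω ^ p ∂P := by
          rw [lintegral_tsum fun p ↦ (hY.pow_const p).const_mul _]
          exact tsum_congr fun p ↦ lintegral_const_mul'' _ (hY.pow_const p)
      _ ≤ ∑' p : ℕ, ENNReal.ofReal (c * C) ^ p := by
          refine ENNReal.tsum_le_tsum fun p ↦ ?_
          refine (mul_le_mul_right (hmom p) _).trans (le_of_eq ?_)
          rw [← ENNReal.ofReal_mul (by positivity), ← ENNReal.ofReal_pow (by positivity), mul_pow]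
          congr 1
          field_simp
      _ = (1 - ENNReal.ofReal (c * C))⁻¹ := ENNReal.tsum_geometric _
      _ ≤ _ := le_add_self

theorem one_add_inv_one_sub_lt_top {c C : ℝ} (hC : 0 < C) (hc : c < 1 / C) :
    1 + (1 - ENNReal.ofReal (c * C))⁻¹ < ∞ := by
  have : ENNReal.ofReal (c * C) < 1 := by
    rw [← ENNReal.ofReal_one, ENNReal.ofReal_lt_ofReal_iff one_pos]
    exact (lt_div_iff₀ hC).1 hc
  rw [ENNReal.add_lt_top]
  exact ⟨ENNReal.one_lt_top, ENNReal.inv_lt_top.2 (tsub_pos_of_lt this)⟩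

/-! ### An auxiliary integral -/

theorem lintegral_rpow_neg_half_mul_inv_le {u : ℝ} (hu : 0 < u) :
    ∫⁻ r in Set.Ioi (0 : ℝ), ENNReal.ofReal (r ^ (-(1 / 2) : ℝ) * (r + u)⁻¹) ≤
      ENNReal.ofReal (4 * u ^ (-(1 / 2) : ℝ)) := by
  have h1 : ∫⁻ r in Set.Ioc 0 u, ENNReal.ofReal (r ^ (-(1 / 2) : ℝ) * (r + u)⁻¹) ≤
      ENNReal.ofReal (2 * u ^ (-(1 / 2) : ℝ)) := by
    have hint : IntegrableOn (fun r : ℝ ↦ r ^ (-(1 / 2) : ℝ) * u⁻¹) (Set.Ioc 0 u) := by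
      have := (intervalIntegral.intervalIntegrable_rpow' (a := 0) (b := u)
        (r := -(1 / 2)) (by norm_num)).mul_const u⁻¹
      exact (intervalIntegrable_iff_integrableOn_Ioc_of_le hu.le).1 this
    calc _ ≤ ∫⁻ r in Set.Ioc 0 u, ENNReal.ofReal (r ^ (-(1 / 2) : ℝ) * u⁻¹) := by
          refine setLIntegral_mono' measurableSet_Ioc fun r hr ↦ ENNReal.ofReal_le_ofReal ?_
          have := hr.1
          gcongr
          linarith
      _ = ENNReal.ofReal (∫ r in Set.Ioc 0 u, r ^ (-(1 / 2) : ℝ) * u⁻¹) := by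
          refine (ofReal_integral_eq_lintegral_ofReal hint ?_).symm
          refine (ae_restrict_iff' measurableSet_Ioc).2 (ae_of_all _ fun r hr ↦ ?_)
          have := hr.1
          positivity
      _ = _ := by
          rw [← intervalIntegral.integral_of_le hu.le, intervalIntegral.integral_mul_const,
            integral_rpow (.inl (by norm_num)), Real.zero_rpow (by norm_num)]
          congr 1
          rw [show (-(1 / 2) : ℝ) + 1 = -(1 / 2) + 1 by rfl, Real.rpow_add_one hu.ne']
          field_simp
          norm_num
  have h2 : ∫⁻ r in Set.Ioi u, ENNReal.ofReal (r ^ (-(1 / 2) : ℝ) * (r + u)⁻¹) ≤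
      ENNReal.ofReal (2 * u ^ (-(1 / 2) : ℝ)) := by
    calc _ ≤ ∫⁻ r in Set.Ioi u, ENNReal.ofReal (r ^ (-(3 / 2) : ℝ)) := by
          refine setLIntegral_mono' measurableSet_Ioi fun r hr ↦ ENNReal.ofReal_le_ofReal ?_
          have hr0 : 0 < r := hu.trans hr
          rw [show (-(3 / 2) : ℝ) = -(1 / 2) + -1 by norm_num, Real.rpow_add hr0,
            Real.rpow_neg_one]
          gcongr
          linarith
      _ = ENNReal.ofReal (∫ r in Set.Ioi u, r ^ (-(3 / 2) : ℝ)) := by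
          refine (ofReal_integral_eq_lintegral_ofReal
            (integrableOn_Ioi_rpow_of_lt (by norm_num) hu) ?_).symm
          refine (ae_restrict_iff' measurableSet_Ioi).2 (ae_of_all _ fun r hr ↦ ?_)
          have hr0 : 0 < r := hu.trans hr
          positivity
      _ = _ := by
          rw [integral_Ioi_rpow_of_lt (by norm_num) hu]
          congr 1
          norm_num
          ring
  rw [← Set.Ioc_union_Ioi_eq_Ioi hu.le, lintegral_union measurableSet_Ioi
    Set.Ioc_disjoint_Ioi_same, show 4 * u ^ (-(1 / 2) : ℝ) =
      2 * u ^ (-(1 / 2) : ℝ) + 2 * u ^ (-(1 / 2) : ℝ) by ring,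
    ENNReal.ofReal_add (by positivity) (by positivity)]
  exact add_le_add h1 h2

end SRW4

/-! ### Heat kernels and the Brownian Green function -/

namespace SRW4

noncomputable section

/-- The one-dimensional heat kernel, up to a factor `√(2π)`. -/
def heat (r w : ℝ) : ℝ := r ^ (-(1 / 2) : ℝ) * Real.exp (-(w ^ 2 / (2 * r)))

theorem heat_nonneg {r : ℝ} (hr : 0 < r) (w : ℝ) : 0 ≤ heat r w := by
  unfold heat
  positivity

@[fun_prop]
theorem measurable_heat {α : Type*} [MeasurableSpace α] {f g : α → ℝ} (hf : Measurable f)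
    (hg : Measurable g) : Measurable fun a ↦ heat (f a) (g a) := by
  unfold heat
  fun_prop

theorem heat_neg (r w : ℝ) : heat r (-w) = heat r w := by simp [heat]

theorem lintegral_exp_neg_mul_sub_sq {b : ℝ} (hb : 0 < b) (c : ℝ) :
    ∫⁻ z : ℝ, ENNReal.ofReal (Real.exp (-b * (z - c) ^ 2)) = ENNReal.ofReal (√(Real.pi / b)) := by
  rw [lintegral_sub_right_eq_self (fun z : ℝ ↦ ENNReal.ofReal (Real.exp (-b * z ^ 2))),
    ← ofReal_integral_eq_lintegral_ofReal (integrable_exp_neg_mul_sq hb)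
      (ae_of_all _ fun _ ↦ by positivity), integral_gaussian]

theorem lintegral_heat_mul_heat {r s : ℝ} (hr : 0 < r) (hs : 0 < s) (x y : ℝ) :
    ∫⁻ z : ℝ, ENNReal.ofReal (heat r (x - z)) * ENNReal.ofReal (heat s (y - z)) =
      ENNReal.ofReal (√(2 * Real.pi)) * ENNReal.ofReal (heat (r + s) (x - y)) := by
  set A : ℝ := (r * s) ^ (-(1 / 2) : ℝ) * Real.exp (-((x - y) ^ 2 / (2 * (r + s)))) with hA
  have hA0 : 0 ≤ A := by positivity
  have h : ∀ z, ENNReal.ofReal (heat r (x - z)) * ENNReal.ofReal (heat s (y - z)) =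
      ENNReal.ofReal A * ENNReal.ofReal
        (Real.exp (-((r + s) / (2 * r * s)) * (z - (s * x + r * y) / (r + s)) ^ 2)) := by
    intro z
    rw [← ENNReal.ofReal_mul (heat_nonneg hr _), ← ENNReal.ofReal_mul hA0, hA, heat, heat,
      Real.mul_rpow hr.le hs.le, mul_mul_mul_comm, mul_assoc _ (Real.exp _) (Real.exp _),
      ← Real.exp_add, ← Real.exp_add]
    congr 3
    field_simp
    ring
  simp_rw [h]
  rw [lintegral_const_mul _ (by fun_prop), lintegral_exp_neg_mul_sub_sq (by positivity),
    ← ENNReal.ofReal_mul hA0, ← ENNReal.ofReal_mul (by positivity)]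
  congr 1
  rw [hA, heat, Real.sqrt_eq_rpow, Real.sqrt_eq_rpow,
    show Real.pi / ((r + s) / (2 * r * s)) = (2 * Real.pi) * ((r * s) * (r + s)⁻¹) by
      field_simp, Real.mul_rpow (x := 2 * Real.pi) (by positivity) (by positivity),
    Real.mul_rpow (x := r * s) (by positivity) (by positivity), Real.inv_rpow (by positivity),
    ← Real.rpow_neg (by positivity)]
  have : (r * s) ^ (-(1 / 2) : ℝ) * (r * s) ^ (1 / 2 : ℝ) = 1 := by
    rw [← Real.rpow_add (by positivity)]
    norm_num
  linear_combination (Real.exp (-((x - y) ^ 2 / (2 * (r + s)))) * (2 * Real.pi) ^ (1 / 2 : ℝ) *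
    (r + s) ^ (-(1 / 2) : ℝ)) * this

theorem lintegral_heat_gaussianReal {r u : ℝ} (hr : 0 < r) (hu : 0 < u) (w : ℝ) :
    ∫⁻ ξ, ENNReal.ofReal (heat r (w + √u * ξ)) ∂(gaussianReal 0 1) =
      ENNReal.ofReal (heat (r + u) w) := by
  have hu' : Real.toNNReal u ≠ 0 := by simpa using hu
  have hmap : (gaussianReal 0 1).map (√u * ·) = gaussianReal 0 (Real.toNNReal u) := by
    rw [gaussianReal_map_const_mul]
    congr 1
    · simp
    · ext
      simp [Real.sq_sqrt hu.le, hu.le]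
  have hm : Measurable fun ξ : ℝ ↦ ENNReal.ofReal (heat r (w + ξ)) :=
    by fun_prop
  have hm' : Measurable fun ξ : ℝ ↦ ENNReal.ofReal (heat u (0 - ξ)) :=
    by fun_prop
  have hm'' : Measurable fun ξ : ℝ ↦ ENNReal.ofReal (heat r (-w - ξ)) :=
    by fun_prop
  have hpdf : ∀ ξ, gaussianPDF 0 (Real.toNNReal u) ξ =
      ENNReal.ofReal ((√(2 * Real.pi))⁻¹) * ENNReal.ofReal (heat u (0 - ξ)) := by
    intro ξ
    rw [gaussianPDF, gaussianPDFReal, ← ENNReal.ofReal_mul (by positivity), heat,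
      Real.coe_toNNReal _ hu.le, Real.sqrt_mul (by positivity), mul_inv, Real.sqrt_eq_rpow u,
      ← Real.rpow_neg hu.le, mul_assoc]
    congr 4
    ring_nf
  have h1 : ∫⁻ ξ, ENNReal.ofReal (heat r (w + √u * ξ)) ∂(gaussianReal 0 1) =
      ∫⁻ ξ, ENNReal.ofReal (heat r (w + ξ)) ∂((gaussianReal 0 1).map (√u * ·)) :=
    (lintegral_map hm (by fun_prop)).symm
  rw [h1, hmap, gaussianReal_of_var_ne_zero _ hu',
    lintegral_withDensity_eq_lintegral_mul _ (measurable_gaussianPDF _ _) hm]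
  simp only [Pi.mul_apply, hpdf]
  have h2 : ∀ ξ, ENNReal.ofReal ((√(2 * Real.pi))⁻¹) * ENNReal.ofReal (heat u (0 - ξ)) *
      ENNReal.ofReal (heat r (w + ξ)) = ENNReal.ofReal ((√(2 * Real.pi))⁻¹) *
        (ENNReal.ofReal (heat r (-w - ξ)) * ENNReal.ofReal (heat u (0 - ξ))) := by
    intro ξ
    rw [← heat_neg r (-w - ξ)]
    ring_nf
  simp_rw [h2]
  rw [lintegral_const_mul _ (by exact hm''.mul hm'), lintegral_heat_mul_heat hr hu, ← mul_assoc,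
    ← ENNReal.ofReal_mul (by positivity), inv_mul_cancel₀ (by positivity), ENNReal.ofReal_one,
    one_mul, sub_zero, heat_neg]

/-- The four-dimensional heat kernel between a point of Euclidean space and a point of `ℝ⁴`, up to
a factor `(2π)²`. -/
def heat4 (r : ℝ) (x : EuclideanSpace ℝ (Fin 4)) (z : Fin 4 → ℝ) : ℝ≥0∞ :=
  ∏ i, ENNReal.ofReal (heat r (x i - z i))

theorem heat4_eq {r : ℝ} (hr : 0 < r) (x y : EuclideanSpace ℝ (Fin 4)) :
    heat4 r x y = ENNReal.ofReal ((r ^ 2)⁻¹ * Real.exp (-(‖x - y‖ ^ 2 / (2 * r)))) := by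
  rw [heat4, ← ENNReal.ofReal_prod_of_nonneg fun i _ ↦ heat_nonneg hr _]
  simp only [heat, Finset.prod_mul_distrib, Finset.prod_const, Finset.card_univ, Fintype.card_fin,
    ← Real.exp_sum, Finset.sum_neg_distrib, ← Finset.sum_div, EuclideanSpace.norm_sq_eq,
    PiLp.sub_apply, Real.norm_eq_abs, sq_abs]
  rw [← Real.rpow_natCast, ← Real.rpow_mul hr.le]
  congr 2
  rw [show (-(1 / 2) : ℝ) * (4 : ℕ) = -(2 : ℕ) by norm_num, Real.rpow_neg hr.le, Real.rpow_natCast]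

@[fun_prop]
theorem measurable_heat4 {α : Type*} [MeasurableSpace α] {r : α → ℝ}
    {f : α → EuclideanSpace ℝ (Fin 4)} {g : α → Fin 4 → ℝ} (hr : Measurable r)
    (hf : Measurable f) (hg : Measurable g) : Measurable fun a ↦ heat4 (r a) (f a) (g a) := by
  unfold heat4
  fun_prop

theorem lintegral_heat4_mul_heat4 {r s : ℝ} (hr : 0 < r) (hs : 0 < s)
    (x y : EuclideanSpace ℝ (Fin 4)) :
    ∫⁻ z, heat4 r x z * heat4 s y z =
      ENNReal.ofReal ((2 * Real.pi) ^ 2) * heat4 (r + s) x y := by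
  simp only [heat4, ← Finset.prod_mul_distrib]
  have hm : ∀ {r : ℝ} (a : ℝ), Measurable fun z : ℝ ↦ ENNReal.ofReal (heat r (a - z)) :=
    fun {r} a ↦ by fun_prop
  rw [volume_pi, lintegral_fin_prod_eq_prod (fun _ : Fin 4 ↦ (volume : Measure ℝ))
    (f := fun i z ↦ ENNReal.ofReal (heat r (x i - z)) * ENNReal.ofReal (heat s (y i - z)))
    fun i ↦ (hm _).mul (hm _)]
  simp only [lintegral_heat_mul_heat hr hs, Finset.prod_mul_distrib, Finset.prod_const,
    Finset.card_univ, Fintype.card_fin]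
  rw [← ENNReal.ofReal_pow (by positivity), show √(2 * Real.pi) ^ 4 = (√(2 * Real.pi) ^ 2) ^ 2 by
    ring, Real.sq_sqrt (by positivity)]

theorem lintegral_heat4_stdGaussian {r u : ℝ} (hr : 0 < r) (hu : 0 < u)
    (x : EuclideanSpace ℝ (Fin 4)) (z : Fin 4 → ℝ) :
    ∫⁻ ξ, heat4 r (x + ξ) z
      ∂((stdGaussian (EuclideanSpace ℝ (Fin 4))).map fun w ↦ √u • w) = heat4 (r + u) x z := by
  have hm : Measurable fun ξ ↦ heat4 r (x + ξ) z := by fun_prop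
  have hm' : Measurable fun ξ ↦ heat4 r (x + √u • ξ) z := by fun_prop
  rw [lintegral_map hm (by fun_prop), ← map_pi_eq_stdGaussian, lintegral_map hm' (by fun_prop)]
  simp only [heat4, PiLp.add_apply, PiLp.smul_apply, smul_eq_mul]
  have hm1 : ∀ i, Measurable fun ξ : ℝ ↦ ENNReal.ofReal (heat r (x i + √u * ξ - z i)) :=
    fun i ↦ by fun_prop
  rw [lintegral_fin_prod_eq_prod (fun _ : Fin 4 ↦ gaussianReal 0 1) hm1]
  refine Finset.prod_congr rfl fun i _ ↦ ?_
  simp_rw [add_sub_right_comm]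
  exact lintegral_heat_gaussianReal hr hu _

/-- A square root of the Brownian Green function, up to a constant factor. -/
def sqrtGreenBM (x : EuclideanSpace ℝ (Fin 4)) (z : Fin 4 → ℝ) : ℝ≥0∞ :=
  ∫⁻ r in Set.Ioi (0 : ℝ), ENNReal.ofReal (r ^ (-(1 / 2) : ℝ)) * heat4 r x z

theorem measurable_sqrtGreenBM : Measurable (Function.uncurry sqrtGreenBM) := by
  refine Measurable.lintegral_prod_right' (f := fun q : (EuclideanSpace ℝ (Fin 4) ×
    (Fin 4 → ℝ)) × ℝ ↦ ENNReal.ofReal (q.2 ^ (-(1 / 2) : ℝ)) * heat4 q.2 q.1.1 q.1.2) ?_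
  fun_prop

theorem lintegral_sqrtGreenBM_stdGaussian {u : ℝ} (hu : 0 < u)
    (x : EuclideanSpace ℝ (Fin 4)) (z : Fin 4 → ℝ) :
    ∫⁻ ξ, sqrtGreenBM (x + ξ) z
      ∂((stdGaussian (EuclideanSpace ℝ (Fin 4))).map fun w ↦ √u • w) =
      ∫⁻ r in Set.Ioi (0 : ℝ), ENNReal.ofReal (r ^ (-(1 / 2) : ℝ)) * heat4 (r + u) x z := by
  have : IsProbabilityMeasure
      ((stdGaussian (EuclideanSpace ℝ (Fin 4))).map fun w ↦ √u • w) :=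
    Measure.isProbabilityMeasure_map (by fun_prop)
  unfold sqrtGreenBM
  rw [lintegral_lintegral_swap]
  · refine setLIntegral_congr_fun measurableSet_Ioi fun r hr ↦ ?_
    have hm : Measurable fun ξ ↦ heat4 r (x + ξ) z := by fun_prop
    simp only
    rw [lintegral_const_mul _ hm, lintegral_heat4_stdGaussian hr hu]
  · refine Measurable.aemeasurable ?_
    unfold Function.uncurry
    fun_prop

theorem lintegral_mul_superposition_heat4 {u : ℝ} (hu : 0 ≤ u) (x y : EuclideanSpace ℝ (Fin 4)) :
    ∫⁻ z, (∫⁻ r in Set.Ioi (0 : ℝ), ENNReal.ofReal (r ^ (-(1 / 2) : ℝ)) * heat4 (r + u) x z) *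
      (∫⁻ r in Set.Ioi (0 : ℝ), ENNReal.ofReal (r ^ (-(1 / 2) : ℝ)) * heat4 (r + u) y z) =
    ∫⁻ r in Set.Ioi (0 : ℝ), ∫⁻ s in Set.Ioi (0 : ℝ), ENNReal.ofReal (r ^ (-(1 / 2) : ℝ)) *
      ENNReal.ofReal (s ^ (-(1 / 2) : ℝ)) *
        (ENNReal.ofReal ((2 * Real.pi) ^ 2) * heat4 ((r + u) + (s + u)) x y) := by
  set ν : Measure ℝ := volume.restrict (Set.Ioi 0)
  have hmz : ∀ (x : EuclideanSpace ℝ (Fin 4)) (z : Fin 4 → ℝ), Measurable fun r : ℝ ↦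
      ENNReal.ofReal (r ^ (-(1 / 2) : ℝ)) * heat4 (r + u) x z := fun x z ↦ by fun_prop
  have hm2 : Measurable fun q : (Fin 4 → ℝ) × (ℝ × ℝ) ↦
      (ENNReal.ofReal (q.2.1 ^ (-(1 / 2) : ℝ)) * heat4 (q.2.1 + u) x q.1) *
      (ENNReal.ofReal (q.2.2 ^ (-(1 / 2) : ℝ)) * heat4 (q.2.2 + u) y q.1) :=
    by fun_prop
  calc _ = ∫⁻ z : Fin 4 → ℝ, ∫⁻ q : ℝ × ℝ, (ENNReal.ofReal (q.1 ^ (-(1 / 2) : ℝ)) * heat4 (q.1 + u) x z) *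
        (ENNReal.ofReal (q.2 ^ (-(1 / 2) : ℝ)) * heat4 (q.2 + u) y z) ∂(ν.prod ν) := by
        refine lintegral_congr fun z ↦ ?_
        exact (lintegral_prod_mul (hmz x z).aemeasurable (hmz y z).aemeasurable).symm
    _ = ∫⁻ q : ℝ × ℝ, ∫⁻ z : Fin 4 → ℝ, (ENNReal.ofReal (q.1 ^ (-(1 / 2) : ℝ)) * heat4 (q.1 + u) x z) *
        (ENNReal.ofReal (q.2 ^ (-(1 / 2) : ℝ)) * heat4 (q.2 + u) y z) ∂volume ∂(ν.prod ν) :=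
        lintegral_lintegral_swap hm2.aemeasurable
    _ = ∫⁻ r, ∫⁻ s, ∫⁻ z : Fin 4 → ℝ, (ENNReal.ofReal (r ^ (-(1 / 2) : ℝ)) * heat4 (r + u) x z) *
        (ENNReal.ofReal (s ^ (-(1 / 2) : ℝ)) * heat4 (s + u) y z) ∂volume ∂ν ∂ν :=
        lintegral_prod _ (hm2.comp measurable_swap).lintegral_prod_right'.aemeasurable
    _ = _ := by
        refine setLIntegral_congr_fun measurableSet_Ioi fun r hr ↦ ?_
        refine setLIntegral_congr_fun measurableSet_Ioi fun s hs ↦ ?_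
        have hr : 0 < r := hr
        have hs : 0 < s := hs
        have hmm : Measurable fun z ↦ heat4 (r + u) x z * heat4 (s + u) y z := by
          fun_prop
        simp_rw [mul_mul_mul_comm (ENNReal.ofReal (r ^ (-(1 / 2) : ℝ)))]
        rw [lintegral_const_mul _ hmm, lintegral_heat4_mul_heat4 (by positivity) (by positivity)]
        ring

theorem lintegral_sq_superposition_heat4_le {u : ℝ} (hu : 0 < u)
    (x : EuclideanSpace ℝ (Fin 4)) :
    ∫⁻ z, (∫⁻ r in Set.Ioi (0 : ℝ), ENNReal.ofReal (r ^ (-(1 / 2) : ℝ)) *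
      heat4 (r + u) x z) ^ 2 ≤ ENNReal.ofReal (16 * Real.pi ^ 2) / ENNReal.ofReal u := by
  simp_rw [sq (lintegral _ _)]
  rw [lintegral_mul_superposition_heat4 hu.le]
  calc _ ≤ ∫⁻ r in Set.Ioi (0 : ℝ), ∫⁻ s in Set.Ioi (0 : ℝ), ENNReal.ofReal (Real.pi ^ 2) *
        (ENNReal.ofReal (r ^ (-(1 / 2) : ℝ) * (r + u)⁻¹) *
        ENNReal.ofReal (s ^ (-(1 / 2) : ℝ) * (s + u)⁻¹)) := by
        refine setLIntegral_mono' measurableSet_Ioi fun r hr ↦ ?_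
        refine setLIntegral_mono' measurableSet_Ioi fun s hs ↦ ?_
        have hr : 0 < r := hr
        have hs : 0 < s := hs
        rw [heat4_eq (by positivity), ← ENNReal.ofReal_mul (by positivity),
          ← ENNReal.ofReal_mul (by positivity), ← ENNReal.ofReal_mul (by positivity),
          ← ENNReal.ofReal_mul (by positivity), ← ENNReal.ofReal_mul (by positivity)]
        refine ENNReal.ofReal_le_ofReal ?_
        simp only [sub_self, norm_zero, ne_eq, OfNat.ofNat_ne_zero, not_false_eq_true, zero_pow,
          zero_div, neg_zero, Real.exp_zero, mul_one]
        have h4 : (((r + u) + (s + u)) ^ 2)⁻¹ ≤ (4 * ((r + u) * (s + u)))⁻¹ := by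
          gcongr
          nlinarith [sq_nonneg (r - s)]
        calc r ^ (-(1 / 2) : ℝ) * s ^ (-(1 / 2) : ℝ) *
              ((2 * Real.pi) ^ 2 * (((r + u) + (s + u)) ^ 2)⁻¹)
            ≤ r ^ (-(1 / 2) : ℝ) * s ^ (-(1 / 2) : ℝ) *
              ((2 * Real.pi) ^ 2 * (4 * ((r + u) * (s + u)))⁻¹) := by gcongr
          _ = _ := by
            rw [mul_inv, mul_inv]
            ring
    _ = ENNReal.ofReal (Real.pi ^ 2) *
        (∫⁻ r in Set.Ioi (0 : ℝ), ENNReal.ofReal (r ^ (-(1 / 2) : ℝ) * (r + u)⁻¹)) ^ 2 := by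
        have hm : Measurable fun r : ℝ ↦ ENNReal.ofReal (r ^ (-(1 / 2) : ℝ) * (r + u)⁻¹) := by
          fun_prop
        have e : ∀ r : ℝ, ∫⁻ s in Set.Ioi (0 : ℝ), ENNReal.ofReal (Real.pi ^ 2) *
            (ENNReal.ofReal (r ^ (-(1 / 2) : ℝ) * (r + u)⁻¹) *
            ENNReal.ofReal (s ^ (-(1 / 2) : ℝ) * (s + u)⁻¹)) = ENNReal.ofReal (Real.pi ^ 2) *
            (ENNReal.ofReal (r ^ (-(1 / 2) : ℝ) * (r + u)⁻¹) *
            ∫⁻ s in Set.Ioi (0 : ℝ), ENNReal.ofReal (s ^ (-(1 / 2) : ℝ) * (s + u)⁻¹)) := fun r ↦ by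
          rw [lintegral_const_mul _ (hm.const_mul _), lintegral_const_mul _ hm]
        simp only [e]
        rw [lintegral_const_mul _ (hm.mul_const _), lintegral_mul_const _ hm, sq (lintegral _ _)]
    _ ≤ ENNReal.ofReal (Real.pi ^ 2) * ENNReal.ofReal (4 * u ^ (-(1 / 2) : ℝ)) ^ 2 := by
        gcongr
        exact lintegral_rpow_neg_half_mul_inv_le hu
    _ = _ := by
        rw [← ENNReal.ofReal_pow (by positivity), ← ENNReal.ofReal_mul (by positivity),
          ← ENNReal.ofReal_div_of_pos hu, mul_pow, ← Real.rpow_natCast (u ^ _),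
          ← Real.rpow_mul hu.le]
        congr 1
        norm_num [Real.rpow_neg_one]
        ring

theorem le_lintegral_sqrtGreenBM_mul {R : ℝ} (hR : 0 < R) {x y : EuclideanSpace ℝ (Fin 4)}
    (hxy : ‖x - y‖ ^ 2 ≤ R) :
    ENNReal.ofReal (1 / (2 * Real.pi ^ 2) / R) ≤ ∫⁻ z, sqrtGreenBM x z * sqrtGreenBM y z := by
  have h := lintegral_mul_superposition_heat4 le_rfl x y
  simp only [add_zero] at h
  unfold sqrtGreenBM
  rw [h]
  have hsub : Set.Ioc R (2 * R) ⊆ Set.Ioi (0 : ℝ) := fun r hr ↦ hR.trans hr.1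
  set K : ℝ := 1 / (2 * R) * ((2 * Real.pi) ^ 2 * ((16 * R ^ 2)⁻¹ * Real.exp (-1))) with hK
  calc ENNReal.ofReal (1 / (2 * Real.pi ^ 2) / R)
      ≤ ENNReal.ofReal (K * (R * R)) := by
        refine ENNReal.ofReal_le_ofReal ?_
        have e1 : Real.exp 1 < 3 := by linarith [Real.exp_one_lt_d9]
        have e2 : 1 / 3 ≤ Real.exp (-1) := by
          rw [Real.exp_neg, ← one_div]
          gcongr
        have hpi : 3 < Real.pi := Real.pi_gt_three
        have e3 : 1 / (2 * Real.pi ^ 2) / R ≤ 1 / 18 / R := by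
          gcongr
          nlinarith
        have e4 : K * (R * R) = (Real.pi ^ 2 * Real.exp (-1) / 8) / R := by
          rw [hK]
          field_simp
          norm_num
        rw [e4]
        refine e3.trans ?_
        gcongr ?_ / R
        nlinarith
    _ = ∫⁻ r in Set.Ioc R (2 * R), ∫⁻ s in Set.Ioc R (2 * R), ENNReal.ofReal K := by
        simp only [lintegral_const, Measure.restrict_apply MeasurableSet.univ, Set.univ_inter,
          Real.volume_Ioc]
        rw [← ENNReal.ofReal_mul (by positivity), ← ENNReal.ofReal_mul]
        · congr 1
          ring
        · have : 0 ≤ 2 * R - R := by linarith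
          positivity
    _ ≤ ∫⁻ r in Set.Ioc R (2 * R), ∫⁻ s in Set.Ioc R (2 * R),
          ENNReal.ofReal (r ^ (-(1 / 2) : ℝ)) * ENNReal.ofReal (s ^ (-(1 / 2) : ℝ)) *
          (ENNReal.ofReal ((2 * Real.pi) ^ 2) * heat4 (r + s) x y) := by
        refine setLIntegral_mono' measurableSet_Ioc fun r hr ↦ ?_
        refine setLIntegral_mono' measurableSet_Ioc fun s hs ↦ ?_
        have hr0 : 0 < r := hsub hr
        have hs0 : 0 < s := hsub hs
        obtain ⟨hr1, hr2⟩ := hr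
        obtain ⟨hs1, hs2⟩ := hs
        rw [heat4_eq (by positivity), ← ENNReal.ofReal_mul (by positivity),
          ← ENNReal.ofReal_mul (by positivity), ← ENNReal.ofReal_mul (by positivity)]
        refine ENNReal.ofReal_le_ofReal ?_
        rw [hK, ← Real.mul_rpow hr0.le hs0.le]
        have f1 : 1 / (2 * R) ≤ (r * s) ^ (-(1 / 2) : ℝ) := by
          rw [Real.rpow_neg (by positivity), ← Real.sqrt_eq_rpow, one_div]
          gcongr
          rw [Real.sqrt_le_left (by positivity)]
          nlinarith
        have f2 : (16 * R ^ 2)⁻¹ ≤ ((r + s) ^ 2)⁻¹ := by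
          gcongr
          nlinarith
        have f3 : Real.exp (-1) ≤ Real.exp (-(‖x - y‖ ^ 2 / (2 * (r + s)))) := by
          gcongr
          rw [div_le_one (by positivity)]
          linarith
        gcongr
    _ ≤ _ := by
        refine (lintegral_mono_set hsub).trans (lintegral_mono fun r ↦ ?_)
        exact lintegral_mono_set hsub

theorem greenBM_le_lintegral (x y : EuclideanSpace ℝ (Fin 4)) :
    greenBM x y ≤ ∫⁻ z, sqrtGreenBM x z * sqrtGreenBM y z := by
  rcases eq_or_ne x y with rfl | hxy
  · refine le_trans le_top (le_of_eq (Eq.symm ?_))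
    refine ENNReal.eq_top_of_forall_nnreal_le fun r ↦ ?_
    have hr : (0 : ℝ) < 1 / (2 * Real.pi ^ 2) / (r + 1) := by positivity
    refine le_trans ?_ (le_lintegral_sqrtGreenBM_mul (x := x) (y := x) hr (by simpa using hr.le))
    rw [div_div_cancel₀ (by positivity), ENNReal.le_ofReal_iff_toReal_le ENNReal.coe_ne_top
      (by positivity)]
    simp
  · have h0 : 0 < ‖x - y‖ := norm_pos_iff.2 (sub_ne_zero.2 hxy)
    refine le_trans (le_of_eq ?_) (le_lintegral_sqrtGreenBM_mul (R := ‖x - y‖ ^ 2)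
      (by positivity) le_rfl)
    rw [greenBM, div_eq_mul_inv _ (‖x - y‖ ^ 2), ENNReal.ofReal_mul (by positivity),
      ENNReal.ofReal_inv_of_pos (by positivity), ENNReal.ofReal_pow (by positivity), ofReal_norm]

end

end SRW4

/-! ### The Brownian energy -/

namespace SRW4

noncomputable section

theorem hasIndepIncrements_congr {Ω T E : Type*} [MeasurableSpace Ω] {P : Measure Ω} [Preorder T]
    [MeasurableSpace E] [Sub E] {X Y : T → Ω → E} (hX : HasIndepIncrements X P)
    (hXY : ∀ t, X t =ᵐ[P] Y t) : HasIndepIncrements Y P := fun n t ht ↦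
  (hX n t ht).congr fun _ ↦ (hXY _).sub (hXY _)

theorem hasIndepIncrements_comp_monotone {Ω T T' E : Type*} [MeasurableSpace Ω] {P : Measure Ω}
    [Preorder T] [Preorder T'] [MeasurableSpace E] [Sub E] {X : T → Ω → E}
    (hX : HasIndepIncrements X P) {τ : T' → T} (hτ : Monotone τ) :
    HasIndepIncrements (fun t ↦ X (τ t)) P := fun n t ht ↦
  hX n (fun k ↦ τ (t k)) fun _ _ hij ↦ hτ (ht hij)

/-- A version of a Brownian motion, indexed by the real numbers, is jointly measurable. -/
theorem IsBrownianMotion.exists_measurable_modification {Ω : Type*} [MeasurableSpace Ω] {d : ℕ}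
    {P : Measure Ω} {B : ℝ≥0 → Ω → EuclideanSpace ℝ (Fin d)} (hB : IsBrownianMotion B P) :
    ∃ X : ℝ → Ω → EuclideanSpace ℝ (Fin d), Measurable (Function.uncurry X) ∧
      ∀ᵐ ω ∂P, ∀ t : ℝ, X t ω = B t.toNNReal ω := by
  classical
  obtain ⟨s, hs, hsm, hs0⟩ := exists_measurable_superset_of_null
    (ae_iff.1 hB.continuous_paths)
  have hcont : ∀ ω, ω ∉ s → Continuous fun t ↦ B t ω := fun ω hω ↦ by
    by_contra hc
    exact hω (hs hc)
  refine ⟨fun t ω ↦ if ω ∈ s then 0 else B t.toNNReal ω, ?_, ?_⟩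
  · refine measurable_uncurry_of_continuous_of_measurable (fun ω ↦ ?_) fun t ↦ ?_
    · by_cases hω : ω ∈ s
      · simp only [hω, if_true]
        exact continuous_const
      · simp only [hω, if_false]
        exact (hcont ω hω).comp continuous_real_toNNReal
    · exact Measurable.ite hsm measurable_const (hB.measurable _)
  · filter_upwards [measure_eq_zero_iff_ae_notMem.1 hs0] with ω hω t
    simp [hω]

theorem IsBrownianMotion.lintegral_sq_sqrtGreenBM_le {Ω : Type*} [MeasurableSpace Ω]
    {P : Measure Ω} {B : ℝ≥0 → Ω → EuclideanSpace ℝ (Fin 4)} (hB : IsBrownianMotion B P)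
    {X : ℝ → Ω → EuclideanSpace ℝ (Fin 4)} (hX : ∀ᵐ ω ∂P, ∀ t : ℝ, X t ω = B t.toNNReal ω)
    {s t : ℝ} (hs : 0 ≤ s) (hst : s ≤ t) (x : EuclideanSpace ℝ (Fin 4)) :
    ∫⁻ z, (∫⁻ ω, sqrtGreenBM (x + (X t ω - X s ω)) z ∂P) ^ 2 ≤
      ENNReal.ofReal (16 * Real.pi ^ 2) / ENNReal.ofReal (t - s) := by
  rcases hst.eq_or_lt with rfl | hst
  · rw [sub_self, ENNReal.ofReal_zero, ENNReal.div_zero]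
    · exact le_top
    · rw [ne_eq, ENNReal.ofReal_eq_zero, not_le]
      positivity
  have hlaw := hB.law_increment s.toNNReal t.toNNReal (Real.toNNReal_le_toNNReal hst.le)
  rw [Real.coe_toNNReal _ hs, Real.coe_toNNReal _ (hs.trans hst.le)] at hlaw
  refine le_trans (le_of_eq ?_) (lintegral_sq_superposition_heat4_le (sub_pos.2 hst) x)
  refine lintegral_congr fun z ↦ ?_
  rw [← lintegral_sqrtGreenBM_stdGaussian (sub_pos.2 hst), ← hlaw.lintegral_comp
    (f := fun ξ ↦ sqrtGreenBM (x + ξ) z)]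
  · congr 1
    refine lintegral_congr_ae ?_
    filter_upwards [hX] with ω hω
    simp [hω]
  · exact (measurable_sqrtGreenBM.comp (f := fun ξ ↦ (x + ξ, z)) (by fun_prop)).aemeasurable

theorem brownianEnergy_moments {Ω : Type*} [MeasurableSpace Ω] {P : Measure Ω}
    [IsProbabilityMeasure P] {B B' : ℝ≥0 → Ω → EuclideanSpace ℝ (Fin 4)}
    (hB : IsBrownianMotion B P) (hB' : IsBrownianMotion B' P)
    (hind : IndepFun (fun ω t ↦ B t ω) (fun ω t ↦ B' t ω) P) :
    AEMeasurable (brownianEnergy B B') P ∧ ∀ p : ℕ, ∫⁻ ω, brownianEnergy B B' ω ^ p ∂P ≤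
      ENNReal.ofReal ((16 * Real.pi ^ 2 * Real.pi * Real.exp 2) ^ p * p.factorial) := by
  obtain ⟨X, hXm, hX⟩ := hB.exists_measurable_modification
  obtain ⟨X', hXm', hX'⟩ := hB'.exists_measurable_modification
  have hXt : ∀ t, X t =ᵐ[P] B t.toNNReal := fun t ↦ by filter_upwards [hX] with ω hω using hω t
  have hXt' : ∀ t, X' t =ᵐ[P] B' t.toNNReal := fun t ↦ by
    filter_upwards [hX'] with ω hω using hω t
  have heq : brownianEnergy B B' =ᵐ[P] fun ω ↦ ∫⁻ s in Set.Icc (0 : ℝ) 1,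
      ∫⁻ t in Set.Icc (0 : ℝ) 1, greenBM (X s ω) (X' t ω) := by
    filter_upwards [hX, hX'] with ω h1 h2
    simp only [brownianEnergy, h1, h2]
  refine ⟨⟨_, ?_, heq⟩, ?_⟩
  · have h1 : Measurable fun q : (Ω × ℝ) × ℝ ↦ X q.1.2 q.1.1 :=
      hXm.comp (f := fun q : (Ω × ℝ) × ℝ ↦ (q.1.2, q.1.1)) (by fun_prop)
    have h2 : Measurable fun q : (Ω × ℝ) × ℝ ↦ X' q.2 q.1.1 :=
      hXm'.comp (f := fun q : (Ω × ℝ) × ℝ ↦ (q.2, q.1.1)) (by fun_prop)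
    have h3 : Measurable fun q : (Ω × ℝ) × ℝ ↦ greenBM (X q.1.2 q.1.1) (X' q.2 q.1.1) := by
      unfold greenBM
      fun_prop
    exact h3.lintegral_prod_right'.lintegral_prod_right'
  · intro p
    refine lintegral_energy_pow_le (X := X) (X' := X') hXm ?_ ?_ hXm' ?_ ?_ ?_
      measurable_sqrtGreenBM volume (by positivity)
      (fun s t hs hst x ↦ hB.lintegral_sq_sqrtGreenBM_le hX hs hst x)
      (fun s t hs hst x ↦ hB'.lintegral_sq_sqrtGreenBM_le hX' hs hst x) ?_ p
    · exact hasIndepIncrements_congr (hasIndepIncrements_comp_monotone hB.indep_increments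
        fun _ _ h ↦ Real.toNNReal_mono h) fun t ↦ (hXt t).symm
    · filter_upwards [hXt 0, hB.zero] with ω h1 h2
      rw [h1, Real.toNNReal_zero, h2]
    · exact hasIndepIncrements_congr (hasIndepIncrements_comp_monotone hB'.indep_increments
        fun _ _ h ↦ Real.toNNReal_mono h) fun t ↦ (hXt' t).symm
    · filter_upwards [hXt' 0, hB'.zero] with ω h1 h2
      rw [h1, Real.toNNReal_zero, h2]
    · intro p s t
      have h1 : Measurable fun (f : ℝ≥0 → EuclideanSpace ℝ (Fin 4)) (k : Fin p) ↦
        f (s k).toNNReal := by fun_prop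
      have h2 : Measurable fun (f : ℝ≥0 → EuclideanSpace ℝ (Fin 4)) (k : Fin p) ↦
        f (t k).toNNReal := by fun_prop
      refine (hind.comp h1 h2).congr ?_ ?_
      · filter_upwards [hX] with ω hω
        ext1 k
        simp [hω]
      · filter_upwards [hX'] with ω hω
        ext1 k
        simp [hω]
    · filter_upwards [heq] with ω hω
      rw [hω]
      exact lintegral_mono fun s ↦ lintegral_mono fun t ↦ greenBM_le_lintegral _ _

end

end SRW4

/-! ### Transition probabilities of simple random walk -/

namespace SRW4

noncomputable section

theorem conv_apply_singleton {G : Type*} [AddGroup G] [MeasurableSpace G] [MeasurableAdd₂ G]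
    [MeasurableSingletonClass G] (μ ν : Measure G) [SFinite μ] [SFinite ν] (v : G) :
    (μ.conv ν) {v} = ∫⁻ b, μ {v - b} ∂ν := by
  rw [Measure.conv, Measure.map_apply measurable_add (measurableSet_singleton v),
    Measure.prod_apply_symm (measurable_add (measurableSet_singleton v))]
  refine lintegral_congr fun b ↦ ?_
  congr 1
  ext a
  simp [eq_sub_iff_add_eq]

theorem lintegral_stepLaw {d : ℕ} (f : (Fin d → ℤ) → ℝ≥0∞) :
    ∫⁻ x, f x ∂(stepLaw d) =
      (2 * d : ℝ≥0∞)⁻¹ * ∑ i : Fin d, (f (Pi.single i 1) + f (-Pi.single i 1)) := by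
  simp [stepLaw, lintegral_smul_measure, lintegral_finsetSum_measure, lintegral_add_measure]

instance isProbabilityMeasure_stepLaw : IsProbabilityMeasure (stepLaw 4) := ⟨by
  rw [← lintegral_one, lintegral_stepLaw]
  simp only [Finset.sum_const, Finset.card_univ, Fintype.card_fin, nsmul_eq_mul]
  rw [one_add_one_eq_two, mul_comm 2]
  exact ENNReal.inv_mul_cancel (by norm_num) (by finiteness)⟩

instance isProbabilityMeasure_walkLaw (x : Fin 4 → ℤ) (n : ℕ) :
    IsProbabilityMeasure (walkLaw x n) := by
  induction n with
  | zero => exact Measure.dirac.isProbabilityMeasure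
  | succ n ih =>
    rw [walkLaw]
    infer_instance

theorem walkLaw_zero_apply (x y : Fin 4 → ℤ) : walkLaw x 0 {y} = if x = y then 1 else 0 := by
  rw [walkLaw, Measure.dirac_apply' _ (measurableSet_singleton y)]
  simp [Set.indicator_apply]

theorem walkLaw_succ_apply (x y : Fin 4 → ℤ) (n : ℕ) :
    walkLaw x (n + 1) {y} = 8⁻¹ * ∑ i : Fin 4,
      (walkLaw x n {y - Pi.single i 1} + walkLaw x n {y + Pi.single i 1}) := by
  rw [walkLaw, conv_apply_singleton, lintegral_stepLaw]
  simp only [sub_neg_eq_add]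
  norm_num

theorem walkLaw_apply_eq_sub (x y : Fin 4 → ℤ) (n : ℕ) :
    walkLaw x n {y} = walkLaw 0 n {y - x} := by
  induction n generalizing y with
  | zero =>
    rw [walkLaw_zero_apply, walkLaw_zero_apply]
    congr 1
    rw [eq_comm (a := (0 : Fin 4 → ℤ)), sub_eq_zero, eq_comm (a := y)]
  | succ n ih =>
    simp only [walkLaw_succ_apply, ih]
    simp only [sub_right_comm, add_sub_right_comm]

theorem walkLaw_zero_neg (n : ℕ) (y : Fin 4 → ℤ) : walkLaw 0 n {-y} = walkLaw 0 n {y} := by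
  induction n generalizing y with
  | zero =>
    rw [walkLaw_zero_apply, walkLaw_zero_apply]
    congr 1
    rw [eq_comm (b := -y), neg_eq_zero, eq_comm (a := y)]
  | succ n ih =>
    simp only [walkLaw_succ_apply]
    congr 1
    refine Finset.sum_congr rfl fun i _ ↦ ?_
    rw [← ih (y - _), ← ih (y + _), add_comm]
    congr 3 <;> abel

theorem walkLaw_add (m n : ℕ) :
    walkLaw (0 : Fin 4 → ℤ) (m + n) = (walkLaw 0 m).conv (walkLaw 0 n) := by
  induction n with
  | zero => rw [add_zero, walkLaw, Measure.conv_dirac_zero]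
  | succ n ih => rw [← add_assoc, walkLaw, ih, Measure.conv_assoc, ← walkLaw]

theorem tsum_walkLaw_mul_walkLaw (m n : ℕ) (x y : Fin 4 → ℤ) :
    ∑' z, walkLaw 0 m {z - x} * walkLaw 0 n {z - y} = walkLaw 0 (m + n) {x - y} := by
  rw [walkLaw_add, conv_apply_singleton, lintegral_countable',
    ← (Equiv.subRight y).tsum_eq fun w ↦ walkLaw 0 m {x - y - w} * walkLaw 0 n {w}]
  refine tsum_congr fun z ↦ ?_
  rw [Equiv.subRight_apply, ← walkLaw_zero_neg m]
  congr 3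
  abel

/-- The weights `(i + 1)^{-1/2}`. -/
def sqrtWeight (i : ℕ) : ℝ≥0∞ := ENNReal.ofReal (((i : ℝ) + 1) ^ (-(1 / 2) : ℝ))

/-- A kernel whose square, as an operator, dominates the Green function. -/
def sqrtGreenSRW (x z : Fin 4 → ℤ) : ℝ≥0∞ := ∑' i, sqrtWeight i * walkLaw 0 i {z - x}

theorem one_le_sum_sqrtWeight_mul (n : ℕ) :
    1 ≤ ∑ q ∈ Finset.HasAntidiagonal.antidiagonal n, sqrtWeight q.1 * sqrtWeight q.2 := by
  have h : ∀ q ∈ Finset.HasAntidiagonal.antidiagonal n,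
      ENNReal.ofReal (1 / (n + 1)) ≤ sqrtWeight q.1 * sqrtWeight q.2 := by
    intro q hq
    rw [sqrtWeight, sqrtWeight, ← ENNReal.ofReal_mul (by positivity),
      ← Real.mul_rpow (by positivity) (by positivity), Real.rpow_neg (by positivity),
      ← Real.sqrt_eq_rpow, one_div]
    refine ENNReal.ofReal_le_ofReal ?_
    have hn : (q.1 : ℝ) + q.2 = n := by exact_mod_cast Finset.HasAntidiagonal.mem_antidiagonal.1 hq
    gcongr
    rw [Real.sqrt_le_left (by positivity), ← hn]
    have h1 : (0 : ℝ) ≤ q.1 := by positivity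
    have h2 : (0 : ℝ) ≤ q.2 := by positivity
    nlinarith
  refine le_trans (le_of_eq ?_) (Finset.sum_le_sum h)
  rw [Finset.sum_const, Finset.Nat.card_antidiagonal, nsmul_eq_mul, ← ENNReal.ofReal_natCast,
    ← ENNReal.ofReal_mul (by positivity)]
  push_cast
  rw [mul_one_div_cancel (by positivity), ENNReal.ofReal_one]

theorem tsum_superposition_mul (j : ℕ) (x y : Fin 4 → ℤ) :
    ∑' z, (∑' i, sqrtWeight i * walkLaw 0 (i + j) {z - x}) *
      (∑' i, sqrtWeight i * walkLaw 0 (i + j) {z - y}) =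
    ∑' i, ∑' k, sqrtWeight i * sqrtWeight k * walkLaw 0 ((i + j) + (k + j)) {x - y} := by
  simp_rw [← ENNReal.tsum_mul_right, ← ENNReal.tsum_mul_left]
  rw [ENNReal.tsum_comm]
  refine tsum_congr fun i ↦ ?_
  rw [ENNReal.tsum_comm]
  refine tsum_congr fun k ↦ ?_
  rw [← tsum_walkLaw_mul_walkLaw, ← ENNReal.tsum_mul_left]
  exact tsum_congr fun z ↦ by ring

theorem greenSRW_le_tsum (x y : Fin 4 → ℤ) :
    greenSRW x y ≤ ∑' z, sqrtGreenSRW x z * sqrtGreenSRW y z := by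
  have h := tsum_superposition_mul 0 x y
  simp only [add_zero] at h
  unfold sqrtGreenSRW greenSRW
  rw [h, ← ENNReal.tsum_prod (f := fun i k ↦
    sqrtWeight i * sqrtWeight k * walkLaw 0 (i + k) {x - y}),
    ← Finset.HasAntidiagonal.sigmaAntidiagonalEquivProd.tsum_eq, ENNReal.tsum_sigma']
  refine ENNReal.tsum_le_tsum fun n ↦ ?_
  rw [tsum_fintype]
  refine le_trans ?_ (Finset.sum_coe_sort (Finset.HasAntidiagonal.antidiagonal n) (fun q ↦
    sqrtWeight q.1 * sqrtWeight q.2 * walkLaw 0 (q.1 + q.2) {x - y})).ge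
  calc walkLaw x n {y} = 1 * walkLaw 0 n {x - y} := by
        rw [one_mul, walkLaw_apply_eq_sub, ← walkLaw_zero_neg, neg_sub]
    _ ≤ (∑ q ∈ Finset.HasAntidiagonal.antidiagonal n, sqrtWeight q.1 * sqrtWeight q.2) *
        walkLaw 0 n {x - y} := by
        gcongr
        exact one_le_sum_sqrtWeight_mul n
    _ = _ := by
        rw [Finset.sum_mul]
        refine Finset.sum_congr rfl fun q hq ↦ ?_
        rw [Finset.HasAntidiagonal.mem_antidiagonal.1 hq]

theorem lintegral_sqrtGreenSRW_walkLaw (j : ℕ) (x z : Fin 4 → ℤ) :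
    ∫⁻ ξ, sqrtGreenSRW (x + ξ) z ∂(walkLaw 0 j) =
      ∑' i, sqrtWeight i * walkLaw 0 (i + j) {z - x} := by
  unfold sqrtGreenSRW
  rw [lintegral_tsum fun i ↦ Measurable.of_discrete.aemeasurable]
  refine tsum_congr fun i ↦ ?_
  rw [lintegral_const_mul _ Measurable.of_discrete, walkLaw_add, conv_apply_singleton]
  simp only [sub_sub]

theorem tsum_sqrtWeight_mul_inv_le (j : ℕ) :
    ∑' i : ℕ, sqrtWeight i * ENNReal.ofReal ((i + j + 1 : ℝ)⁻¹) ≤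
      ENNReal.ofReal (8 * (j + 1 : ℝ) ^ (-(1 / 2) : ℝ)) := by
  have hterm : ∀ i : ℕ, sqrtWeight i * ENNReal.ofReal ((i + j + 1 : ℝ)⁻¹) ≤
      ENNReal.ofReal 2 * ∫⁻ r in Set.Ioc (i : ℝ) (i + 1),
        ENNReal.ofReal (r ^ (-(1 / 2) : ℝ) * (r + (j + 1))⁻¹) := by
    intro i
    have hi : (0 : ℝ) ≤ i := by positivity
    have hj : (0 : ℝ) ≤ j := by positivity
    calc sqrtWeight i * ENNReal.ofReal ((i + j + 1 : ℝ)⁻¹)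
        ≤ ENNReal.ofReal 2 * ∫⁻ _ in Set.Ioc (i : ℝ) (i + 1),
          ENNReal.ofReal ((i + 1 : ℝ) ^ (-(1 / 2) : ℝ) * ((i : ℝ) + 1 + (j + 1))⁻¹) := by
          rw [setLIntegral_const, Real.volume_Ioc, add_sub_cancel_left, ENNReal.ofReal_one,
            mul_one, sqrtWeight, ← ENNReal.ofReal_mul (by positivity),
            ← ENNReal.ofReal_mul (by positivity)]
          refine ENNReal.ofReal_le_ofReal ?_
          rw [mul_left_comm]
          gcongr
          rw [← div_eq_mul_inv, inv_le_comm₀ (by positivity) (by positivity), inv_div]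
          linarith
      _ ≤ _ := by
          gcongr ENNReal.ofReal 2 * ?_
          refine setLIntegral_mono' measurableSet_Ioc fun r hr ↦ ENNReal.ofReal_le_ofReal ?_
          have hr0 : 0 < r := hi.trans_lt hr.1
          have hr1 := hr.2
          gcongr ?_ * (?_)⁻¹
          · exact Real.rpow_le_rpow_of_nonpos hr0 hr1 (by norm_num)
          · linarith
  have hdisj : Pairwise (Function.onFun Disjoint fun i : ℕ ↦ Set.Ioc (i : ℝ) (i + 1)) := by
    have := Set.pairwise_disjoint_Ioc_intCast ℝ
    intro a b hab
    exact_mod_cast this (i := (a : ℤ)) (j := (b : ℤ)) (by exact_mod_cast hab)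
  calc _ ≤ ∑' i : ℕ, ENNReal.ofReal 2 * ∫⁻ r in Set.Ioc (i : ℝ) (i + 1),
        ENNReal.ofReal (r ^ (-(1 / 2) : ℝ) * (r + (j + 1))⁻¹) := ENNReal.tsum_le_tsum hterm
    _ = ENNReal.ofReal 2 * ∫⁻ r in ⋃ i : ℕ, Set.Ioc (i : ℝ) (i + 1),
        ENNReal.ofReal (r ^ (-(1 / 2) : ℝ) * (r + (j + 1))⁻¹) := by
        rw [ENNReal.tsum_mul_left, lintegral_iUnion (fun _ ↦ measurableSet_Ioc) hdisj]
    _ ≤ ENNReal.ofReal 2 * ∫⁻ r in Set.Ioi (0 : ℝ),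
        ENNReal.ofReal (r ^ (-(1 / 2) : ℝ) * (r + (j + 1))⁻¹) := by
        gcongr
        refine Set.iUnion_subset fun i r hr ↦ ?_
        exact (show (0 : ℝ) ≤ i by positivity).trans_lt hr.1
    _ ≤ ENNReal.ofReal 2 * ENNReal.ofReal (4 * (j + 1 : ℝ) ^ (-(1 / 2) : ℝ)) := by
        gcongr
        exact lintegral_rpow_neg_half_mul_inv_le (by positivity)
    _ = _ := by
        rw [← ENNReal.ofReal_mul (by norm_num)]
        congr 1
        ring

end

end SRW4

/-! ### The local bound for simple random walk -/

namespace SRW4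

noncomputable section

/-- The characteristic function of the step distribution. -/
def stepChar (θ : Fin 4 → ℝ) : ℝ := (∑ i, Real.cos (θ i)) / 4

/-- Lebesgue measure on the torus `(-π, π]⁴`. -/
def torusMeasure : Measure (Fin 4 → ℝ) :=
  Measure.pi fun _ ↦ volume.restrict (Set.Ioc (-Real.pi) Real.pi)

instance : IsFiniteMeasure torusMeasure := by
  unfold torusMeasure
  infer_instance

/-- The character `θ ↦ exp (i θ · x)`. -/
def torusChar (x : Fin 4 → ℤ) (θ : Fin 4 → ℝ) : ℂ :=
  ∏ k, Complex.exp (x k * Complex.I * θ k)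

theorem norm_torusChar (x : Fin 4 → ℤ) (θ : Fin 4 → ℝ) : ‖torusChar x θ‖ = 1 := by
  rw [torusChar, norm_prod]
  refine Finset.prod_eq_one fun k _ ↦ ?_
  rw [show (x k : ℂ) * Complex.I * θ k = ((x k * θ k : ℝ) : ℂ) * Complex.I by push_cast; ring,
    Complex.norm_exp_ofReal_mul_I]

theorem torusChar_add (x y : Fin 4 → ℤ) (θ : Fin 4 → ℝ) :
    torusChar (x + y) θ = torusChar x θ * torusChar y θ := by
  simp only [torusChar, ← Finset.prod_mul_distrib, ← Complex.exp_add, Pi.add_apply]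
  refine Finset.prod_congr rfl fun k _ ↦ ?_
  push_cast
  ring_nf

theorem torusChar_single (i : Fin 4) (m : ℤ) (θ : Fin 4 → ℝ) :
    torusChar (Pi.single i m) θ = Complex.exp (m * Complex.I * θ i) := by
  rw [torusChar, Finset.prod_eq_single i]
  · simp
  · intro j _ hj
    simp [Pi.single_eq_of_ne hj]
  · simp

theorem sum_torusChar_step (x : Fin 4 → ℤ) (θ : Fin 4 → ℝ) :
    ∑ i : Fin 4, (torusChar (x - Pi.single i 1) θ + torusChar (x + Pi.single i 1) θ) =
      8 * (stepChar θ * torusChar x θ) := by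
  have h : ∀ i : Fin 4, torusChar (x - Pi.single i 1) θ + torusChar (x + Pi.single i 1) θ =
      torusChar x θ * (2 * Complex.cos (θ i)) := by
    intro i
    rw [sub_eq_add_neg, ← Pi.single_neg, torusChar_add, torusChar_add, torusChar_single,
      torusChar_single, Complex.two_cos]
    push_cast
    ring_nf
  simp only [h, ← Finset.mul_sum, stepChar]
  push_cast
  ring

theorem integral_exp_int (m : ℤ) :
    ∫ t in Set.Ioc (-Real.pi) Real.pi, Complex.exp (m * Complex.I * t) =
      if m = 0 then (2 * Real.pi : ℂ) else 0 := by
  rw [← intervalIntegral.integral_of_le (by linarith [Real.pi_pos])]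
  split_ifs with hm
  · subst hm
    simp
    ring
  · have hc : (m : ℂ) * Complex.I ≠ 0 := by simp [hm]
    rw [integral_exp_mul_complex hc, div_eq_zero_iff]
    left
    rw [sub_eq_zero, Complex.exp_eq_exp_iff_exists_int]
    exact ⟨m, by push_cast; ring⟩

theorem integral_torusChar (x : Fin 4 → ℤ) :
    ∫ θ, torusChar x θ ∂torusMeasure = if x = 0 then ((2 * Real.pi) ^ 4 : ℂ) else 0 := by
  unfold torusChar torusMeasure
  rw [integral_fintype_prod_eq_prod (fun k (t : ℝ) ↦ Complex.exp (x k * Complex.I * t))]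
  simp only [integral_exp_int]
  split_ifs with hx
  · simp [hx]
  · obtain ⟨k, hk⟩ := Function.ne_iff.1 hx
    exact Finset.prod_eq_zero (Finset.mem_univ k) (if_neg hk)

theorem continuous_stepChar : Continuous stepChar := by
  unfold stepChar
  fun_prop

theorem continuous_torusChar (x : Fin 4 → ℤ) : Continuous (torusChar x) := by
  unfold torusChar
  fun_prop

theorem abs_stepChar_le_one (θ : Fin 4 → ℝ) : |stepChar θ| ≤ 1 := by
  rw [stepChar, abs_div, abs_of_pos (four_pos (α := ℝ)), div_le_one four_pos]
  refine (Finset.abs_sum_le_sum_abs _ _).trans ?_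
  refine (Finset.sum_le_sum fun i _ ↦ Real.abs_cos_le_one (θ i)).trans ?_
  simp

theorem integrable_stepChar_mul_torusChar (n : ℕ) (x : Fin 4 → ℤ) :
    Integrable (fun θ ↦ ((stepChar θ : ℂ)) ^ n * torusChar x θ) torusMeasure := by
  refine Integrable.of_bound (C := 1) ?_ (ae_of_all _ fun θ ↦ ?_)
  · have := continuous_stepChar
    have := continuous_torusChar x
    exact Continuous.aestronglyMeasurable (by fun_prop)
  · rw [norm_mul, norm_torusChar, mul_one, norm_pow, Complex.norm_real, Real.norm_eq_abs]
    exact pow_le_one₀ (abs_nonneg _) (abs_stepChar_le_one θ)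

/-- Fourier inversion for the transition probabilities. -/
theorem walkLaw_toReal_eq_integral (n : ℕ) (x : Fin 4 → ℤ) :
    (((walkLaw 0 n {x}).toReal : ℝ) : ℂ) * (2 * Real.pi) ^ 4 =
      ∫ θ, (stepChar θ : ℂ) ^ n * torusChar x θ ∂torusMeasure := by
  induction n generalizing x with
  | zero =>
    simp only [pow_zero, one_mul, integral_torusChar, walkLaw_zero_apply, eq_comm (a := x)]
    split_ifs <;> simp
  | succ n ih =>
    have h1 : (walkLaw 0 (n + 1) {x}).toReal = 8⁻¹ * ∑ i : Fin 4,
        ((walkLaw 0 n {x - Pi.single i 1}).toReal + (walkLaw 0 n {x + Pi.single i 1}).toReal) := by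
      rw [walkLaw_succ_apply, ENNReal.toReal_mul, ENNReal.toReal_sum (by finiteness)]
      simp only [ENNReal.toReal_add (measure_ne_top _ _) (measure_ne_top _ _)]
      norm_num
    rw [h1]
    push_cast
    rw [mul_assoc, Finset.sum_mul]
    simp only [add_mul, ih]
    have h2 : ∀ i : Fin 4, (∫ θ, (stepChar θ : ℂ) ^ n * torusChar (x - Pi.single i 1) θ
        ∂torusMeasure) + (∫ θ, (stepChar θ : ℂ) ^ n * torusChar (x + Pi.single i 1) θ
        ∂torusMeasure) = ∫ θ, (stepChar θ : ℂ) ^ n * (torusChar (x - Pi.single i 1) θ +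
          torusChar (x + Pi.single i 1) θ) ∂torusMeasure := fun i ↦ by
      rw [← integral_add (integrable_stepChar_mul_torusChar n _)
        (integrable_stepChar_mul_torusChar n _)]
      simp only [mul_add]
    simp only [h2]
    rw [← integral_finsetSum]
    · simp only [← Finset.mul_sum, sum_torusChar_step]
      rw [← integral_const_mul]
      refine integral_congr_ae (ae_of_all _ fun θ ↦ ?_)
      simp only
      ring
    · intro i _
      simp only [mul_add]
      exact (integrable_stepChar_mul_torusChar n _).add (integrable_stepChar_mul_torusChar n _)

theorem abs_stepChar_le_exp (θ : Fin 4 → ℝ) :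
    |stepChar θ| ≤ ∏ i, Real.exp (-(Real.sin (θ i) ^ 2 / 8)) := by
  have h : ∀ t : ℝ, |Real.cos t| ≤ 1 - Real.sin t ^ 2 / 2 := by
    intro t
    refine abs_le_of_sq_le_sq ?_ ?_
    · have := Real.cos_sq' t
      nlinarith [sq_nonneg (Real.sin t ^ 2)]
    · nlinarith [Real.sin_sq_le_one t]
  rw [← Real.exp_sum, stepChar, abs_div, abs_of_pos (four_pos (α := ℝ))]
  calc |∑ i, Real.cos (θ i)| / 4 ≤ (∑ i, (1 - Real.sin (θ i) ^ 2 / 2)) / 4 := by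
        gcongr
        exact (Finset.abs_sum_le_sum_abs _ _).trans (Finset.sum_le_sum fun i _ ↦ h (θ i))
    _ = ∑ i, -(Real.sin (θ i) ^ 2 / 8) + 1 := by
        simp only [Fin.sum_univ_four]
        ring
    _ ≤ _ := Real.add_one_le_exp _

theorem exp_sin_sq_le {n : ℝ} (hn : 0 ≤ n) {t : ℝ} (ht : t ∈ Set.Ioc (-Real.pi) Real.pi) :
    Real.exp (-(Real.sin t ^ 2 / 8)) ^ n ≤
      Real.exp (-(n / (2 * Real.pi ^ 2)) * (t - -Real.pi) ^ 2) +
      Real.exp (-(n / (2 * Real.pi ^ 2)) * (t - 0) ^ 2) +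
      Real.exp (-(n / (2 * Real.pi ^ 2)) * (t - Real.pi) ^ 2) := by
  have hpi := Real.pi_pos
  have key : ∀ v : ℝ, |v| ≤ Real.pi / 2 → Real.sin v ^ 2 = Real.sin t ^ 2 →
      Real.exp (-(Real.sin t ^ 2 / 8)) ^ n ≤ Real.exp (-(n / (2 * Real.pi ^ 2)) * v ^ 2) := by
    intro v hv hs
    rw [← Real.exp_mul, Real.exp_le_exp, ← hs]
    have h1 := Real.mul_abs_le_abs_sin hv
    have h2 : (2 / Real.pi * |v|) ^ 2 ≤ |Real.sin v| ^ 2 := by gcongr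
    rw [mul_pow, sq_abs, sq_abs] at h2
    have h3 : n / (2 * Real.pi ^ 2) * v ^ 2 = n / 8 * ((2 / Real.pi) ^ 2 * v ^ 2) := by
      field_simp
      ring
    have h4 := mul_le_mul_of_nonneg_left h2 (by positivity : 0 ≤ n / 8)
    rw [← h3] at h4
    linarith
  have p1 := Real.exp_pos (-(n / (2 * Real.pi ^ 2)) * (t - -Real.pi) ^ 2)
  have p2 := Real.exp_pos (-(n / (2 * Real.pi ^ 2)) * (t - 0) ^ 2)
  have p3 := Real.exp_pos (-(n / (2 * Real.pi ^ 2)) * (t - Real.pi) ^ 2)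
  obtain ⟨ht1, ht2⟩ := ht
  rcases le_or_gt t (-(Real.pi / 2)) with h1 | h1
  · have := key (t - -Real.pi) (by rw [abs_le]; constructor <;> linarith)
      (by rw [sub_neg_eq_add, Real.sin_add_pi, neg_sq])
    linarith
  rcases le_or_gt t (Real.pi / 2) with h2 | h2
  · have := key (t - 0) (by rw [sub_zero, abs_le]; constructor <;> linarith) (by rw [sub_zero])
    linarith
  · have := key (t - Real.pi) (by rw [abs_le]; constructor <;> linarith)
      (by rw [Real.sin_sub_pi, neg_sq])
    linarith

theorem integral_exp_sin_sq_le {n : ℕ} (hn : 0 < n) :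
    ∫ t in Set.Ioc (-Real.pi) Real.pi, Real.exp (-(Real.sin t ^ 2 / 8)) ^ n ≤
      3 * √(2 * Real.pi ^ 3 / n) := by
  have hn' : (0 : ℝ) < n := by exact_mod_cast hn
  have hb : 0 < (n : ℝ) / (2 * Real.pi ^ 2) := by positivity
  have hint : ∀ c : ℝ, Integrable
      fun t : ℝ ↦ Real.exp (-((n : ℝ) / (2 * Real.pi ^ 2)) * (t - c) ^ 2) := fun c ↦
    (integrable_exp_neg_mul_sq hb).comp_sub_right c
  have hval : ∀ c : ℝ, ∫ t : ℝ, Real.exp (-((n : ℝ) / (2 * Real.pi ^ 2)) * (t - c) ^ 2) =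
      √(2 * Real.pi ^ 3 / n) := fun c ↦ by
    rw [integral_sub_right_eq_self (fun t : ℝ ↦ Real.exp (-((n : ℝ) / (2 * Real.pi ^ 2)) * t ^ 2)),
      integral_gaussian]
    congr 1
    field_simp
  calc _ ≤ ∫ t in Set.Ioc (-Real.pi) Real.pi,
        (Real.exp (-((n : ℝ) / (2 * Real.pi ^ 2)) * (t - -Real.pi) ^ 2) +
        Real.exp (-((n : ℝ) / (2 * Real.pi ^ 2)) * (t - 0) ^ 2) +
        Real.exp (-((n : ℝ) / (2 * Real.pi ^ 2)) * (t - Real.pi) ^ 2)) := by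
        refine setIntegral_mono_on ?_ ?_ measurableSet_Ioc fun t ht ↦ ?_
        · exact (Continuous.integrableOn_Icc (by fun_prop)).mono_set Set.Ioc_subset_Icc_self
        · exact (((hint _).add (hint _)).add (hint _)).integrableOn
        · rw [← Real.rpow_natCast]
          exact exp_sin_sq_le hn'.le ht
    _ ≤ ∫ t : ℝ, (Real.exp (-((n : ℝ) / (2 * Real.pi ^ 2)) * (t - -Real.pi) ^ 2) +
        Real.exp (-((n : ℝ) / (2 * Real.pi ^ 2)) * (t - 0) ^ 2) +
        Real.exp (-((n : ℝ) / (2 * Real.pi ^ 2)) * (t - Real.pi) ^ 2)) :=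
        setIntegral_le_integral (((hint _).add (hint _)).add (hint _))
          (ae_of_all _ fun t ↦ by positivity)
    _ = _ := by
        rw [integral_add (by exact (hint _).add (hint _)) (hint _), integral_add (hint _) (hint _)]
        simp only [hval]
        ring

/-- The local bound `P(S_n = x) = O(n⁻²)`. -/
theorem walkLaw_le (n : ℕ) (x : Fin 4 → ℤ) :
    walkLaw 0 n {x} ≤ ENNReal.ofReal (81 * Real.pi ^ 2 / (n + 1) ^ 2) := by
  have hpi : 3 < Real.pi := Real.pi_gt_three
  rcases n.eq_zero_or_pos with rfl | hn
  · refine prob_le_one.trans ?_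
    rw [ENNReal.one_le_ofReal]
    norm_num
    nlinarith
  have hn' : (1 : ℝ) ≤ n := by exact_mod_cast hn
  rw [ENNReal.le_ofReal_iff_toReal_le (measure_ne_top _ _) (by positivity)]
  have h1 : (walkLaw 0 n {x}).toReal * (2 * Real.pi) ^ 4 ≤ (3 * √(2 * Real.pi ^ 3 / n)) ^ 4 := by
    have h := congrArg norm (walkLaw_toReal_eq_integral n x)
    rw [show (((walkLaw 0 n {x}).toReal : ℝ) : ℂ) * (2 * Real.pi) ^ 4 =
      (((walkLaw 0 n {x}).toReal * (2 * Real.pi) ^ 4 : ℝ) : ℂ) by push_cast; ring,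
      Complex.norm_real, Real.norm_of_nonneg (by positivity)] at h
    rw [h]
    calc _ ≤ ∫ θ, ∏ i, Real.exp (-(Real.sin (θ i) ^ 2 / 8)) ^ n ∂torusMeasure := by
          refine norm_integral_le_of_norm_le ?_ (ae_of_all _ fun θ ↦ ?_)
          · refine Integrable.of_bound (C := 1)
              (Continuous.aestronglyMeasurable (by fun_prop)) (ae_of_all _ fun θ ↦ ?_)
            rw [Real.norm_of_nonneg (by positivity)]
            refine Finset.prod_le_one (fun _ _ ↦ by positivity) fun i _ ↦ ?_
            refine pow_le_one₀ (by positivity) ?_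
            rw [Real.exp_le_one_iff]
            have := sq_nonneg (Real.sin (θ i))
            linarith
          · rw [norm_mul, norm_torusChar, mul_one, norm_pow, Complex.norm_real, Real.norm_eq_abs,
              Finset.prod_pow]
            gcongr
            exact abs_stepChar_le_exp θ
      _ = (∫ t in Set.Ioc (-Real.pi) Real.pi, Real.exp (-(Real.sin t ^ 2 / 8)) ^ n) ^ 4 := by
          unfold torusMeasure
          rw [integral_fintype_prod_eq_pow (fun t : ℝ ↦ Real.exp (-(Real.sin t ^ 2 / 8)) ^ n)]
          rfl
      _ ≤ _ := by
          gcongr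
          exact integral_exp_sin_sq_le hn
  have h2 : (3 * √(2 * Real.pi ^ 3 / n)) ^ 4 = 81 * (2 * Real.pi ^ 3 / n) ^ 2 := by
    rw [mul_pow, show √(2 * Real.pi ^ 3 / n) ^ 4 = (√(2 * Real.pi ^ 3 / n) ^ 2) ^ 2 by ring,
      Real.sq_sqrt (by positivity)]
    norm_num
  rw [h2, ← le_div_iff₀ (by positivity)] at h1
  refine h1.trans ?_
  rw [show 81 * (2 * Real.pi ^ 3 / n) ^ 2 / (2 * Real.pi) ^ 4 =
    81 * Real.pi ^ 2 / (2 * n) ^ 2 by field_simp]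
  gcongr
  linarith

end

end SRW4

/-! ### The energy of simple random walks -/

namespace SRW4

noncomputable section

theorem lintegral_sq_sqrtGreenSRW_walkLaw_le (j : ℕ) (x : Fin 4 → ℤ) :
    ∑' z, (∫⁻ ξ, sqrtGreenSRW (x + ξ) z ∂(walkLaw 0 j)) ^ 2 ≤
      ENNReal.ofReal (5184 * Real.pi ^ 2 / (j + 1)) := by
  simp only [lintegral_sqrtGreenSRW_walkLaw, sq (tsum _)]
  rw [tsum_superposition_mul]
  have hterm : ∀ i k : ℕ, sqrtWeight i * sqrtWeight k * walkLaw 0 ((i + j) + (k + j)) {x - x} ≤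
      ENNReal.ofReal (81 * Real.pi ^ 2) * ((sqrtWeight i * ENNReal.ofReal ((i + j + 1 : ℝ)⁻¹)) *
        (sqrtWeight k * ENNReal.ofReal ((k + j + 1 : ℝ)⁻¹))) := by
    intro i k
    rw [mul_mul_mul_comm, mul_left_comm]
    gcongr
    refine (walkLaw_le _ _).trans ?_
    rw [← ENNReal.ofReal_mul (by positivity), ← ENNReal.ofReal_mul (by positivity), ← mul_inv,
      ← div_eq_mul_inv]
    refine ENNReal.ofReal_le_ofReal ?_
    have hi : (0 : ℝ) ≤ i := by positivity
    have hk : (0 : ℝ) ≤ k := by positivity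
    have hj : (0 : ℝ) ≤ j := by positivity
    push_cast
    gcongr
    nlinarith [mul_nonneg hi hk, mul_nonneg hi hj, mul_nonneg hj hk]
  calc _ ≤ ∑' i : ℕ, ∑' k : ℕ, ENNReal.ofReal (81 * Real.pi ^ 2) *
        ((sqrtWeight i * ENNReal.ofReal ((i + j + 1 : ℝ)⁻¹)) *
        (sqrtWeight k * ENNReal.ofReal ((k + j + 1 : ℝ)⁻¹))) :=
        ENNReal.tsum_le_tsum fun i ↦ ENNReal.tsum_le_tsum fun k ↦ hterm i k
    _ = ENNReal.ofReal (81 * Real.pi ^ 2) *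
        (∑' i : ℕ, sqrtWeight i * ENNReal.ofReal ((i + j + 1 : ℝ)⁻¹)) ^ 2 := by
        simp only [ENNReal.tsum_mul_left, ENNReal.tsum_mul_right, sq]
    _ ≤ ENNReal.ofReal (81 * Real.pi ^ 2) *
        ENNReal.ofReal (8 * (j + 1 : ℝ) ^ (-(1 / 2) : ℝ)) ^ 2 := by
        gcongr
        exact tsum_sqrtWeight_mul_inv_le j
    _ = _ := by
        rw [← ENNReal.ofReal_pow (by positivity), ← ENNReal.ofReal_mul (by positivity), mul_pow,
          ← Real.rpow_natCast ((j + 1 : ℝ) ^ _), ← Real.rpow_mul (by positivity)]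
        congr 1
        norm_num [Real.rpow_neg_one]
        ring

variable {Ω : Type*} [MeasurableSpace Ω] {P : Measure Ω} {S : ℕ → Ω → Fin 4 → ℤ}

theorem iIndep_iSup_of_pairwise_disjoint {ι κ : Type*} {m : ι → MeasurableSpace Ω}
    (hle : ∀ i, m i ≤ ‹MeasurableSpace Ω›) (hm : iIndep m P) {T : κ → Set ι}
    (hT : Pairwise (Function.onFun Disjoint T)) : iIndep (fun j ↦ ⨆ i ∈ T j, m i) P := by
  classical
  have : IsProbabilityMeasure P := hm.isProbabilityMeasure
  rw [iIndep_iff]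
  intro s
  induction s using Finset.induction_on with
  | empty => simp
  | insert a s ha ih =>
    intro f hf
    rw [Finset.set_biInter_insert, Finset.prod_insert ha,
      ← ih fun i hi ↦ hf i (Finset.mem_insert_of_mem hi)]
    have hdisj : Disjoint (T a) (⋃ j ∈ s, T j) := by
      simp only [Set.disjoint_iUnion_right]
      exact fun j hj ↦ hT (by rintro rfl; exact ha hj)
    refine (Indep_iff _ _ _).1 (indep_iSup_of_disjoint hle hm hdisj) _ _
      (hf a (Finset.mem_insert_self a s)) ?_
    refine MeasurableSet.biInter (Set.to_countable _) fun j hj ↦ ?_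
    refine (iSup₂_mono' fun i hi ↦ ⟨i, ?_, le_rfl⟩ : (⨆ i ∈ T j, m i) ≤ _) _
      (hf j (Finset.mem_insert_of_mem hj))
    exact Set.mem_biUnion (show j ∈ s from hj) hi

theorem IsSRW.hasIndepIncrements (hS : IsSRW S P) : HasIndepIncrements S P := by
  intro n t ht
  set m : ℕ → MeasurableSpace Ω := fun k ↦
    MeasurableSpace.comap (fun ω ↦ S (k + 1) ω - S k ω) inferInstance with hm
  have hle : ∀ k, m k ≤ ‹MeasurableSpace Ω› := fun k ↦
    ((hS.measurable (k + 1)).sub (hS.measurable k)).comap_le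
  have hT : Pairwise (Function.onFun Disjoint
      fun i : Fin n ↦ Set.Ico (t i.castSucc) (t i.succ)) := by
    have h : ∀ i j : Fin n, i < j →
        Disjoint (Set.Ico (t i.castSucc) (t i.succ)) (Set.Ico (t j.castSucc) (t j.succ)) := by
      intro i j hij
      rw [Set.Ico_disjoint_Ico]
      exact (min_le_left _ _).trans ((ht (Fin.succ_le_castSucc_iff.2 hij)).trans (le_max_right _ _))
    intro i j hij
    rcases lt_or_gt_of_ne hij with h' | h'
    · exact h i j h'
    · exact (h j i h').symm
  have hind := iIndep_iSup_of_pairwise_disjoint hle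
    ((iIndepFun_iff_iIndep _ _ _).1 hS.indep_steps) hT
  have hmeas : ∀ a b, a ≤ b → Measurable[⨆ k ∈ Set.Ico a b, m k] fun ω ↦ S b ω - S a ω := by
    intro a b hab
    induction b, hab using Nat.le_induction with
    | base =>
      simp only [sub_self]
      exact measurable_const
    | succ b hab ih =>
      have h1 : (fun ω ↦ S (b + 1) ω - S a ω) =
          fun ω ↦ (S (b + 1) ω - S b ω) + (S b ω - S a ω) := by
        ext1 ω
        abel
      rw [h1]
      refine Measurable.add (Measurable.mono (comap_measurable _) ?_ le_rfl)
        (Measurable.mono ih ?_ le_rfl)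
      · exact le_iSup₂_of_le b ⟨hab, Nat.lt_succ_self b⟩ le_rfl
      · exact biSup_mono fun k hk ↦ ⟨hk.1, hk.2.trans (Nat.lt_succ_self b)⟩
  rw [iIndepFun_iff_iIndep, iIndep_iff]
  intro s f hf
  refine (iIndep_iff _ _).1 hind s fun i hi ↦ ?_
  exact (hmeas _ _ (ht i.castSucc_le_succ)).comap_le _ (hf i hi)

theorem IsSRW.hasLaw_sub [IsProbabilityMeasure P] (hS : IsSRW S P) (l j : ℕ) :
    HasLaw (fun ω ↦ S (l + j) ω - S l ω) (walkLaw 0 j) P := by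
  induction j with
  | zero => exact hasLaw_dirac_of_ae_eq (ae_of_all _ fun ω ↦ sub_self _)
  | succ j ih =>
    have hind := hS.hasIndepIncrements.indepFun_sub_sub (Nat.le_add_right l j)
      (Nat.le_succ (l + j))
    have h := hind.hasLaw_fun_add ih (hS.law_step (l + j))
    refine h.congr (ae_of_all _ fun ω ↦ ?_)
    simp only
    rw [← add_assoc]
    abel

theorem inv_mul_sum_le_lintegral (n : ℕ) (f : ℕ → ℝ≥0∞) :
    (n : ℝ≥0∞)⁻¹ * ∑ i ∈ Finset.Icc 1 n, f i ≤ ∫⁻ s in Set.Icc (0 : ℝ) 1, f ⌈n * s⌉₊ := by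
  rcases n.eq_zero_or_pos with rfl | hn
  · simp
  have hn' : (0 : ℝ) < n := by exact_mod_cast hn
  have hceil : Measurable fun s : ℝ ↦ ⌈n * s⌉₊ := Nat.measurable_ceil.comp (by fun_prop)
  rw [← lintegral_map (f := f) Measurable.of_discrete hceil, lintegral_countable', Finset.mul_sum]
  refine le_trans (Finset.sum_le_sum fun i hi ↦ ?_) (ENNReal.sum_le_tsum (Finset.Icc 1 n))
  rw [mul_comm]
  gcongr
  obtain ⟨hi1, hi2⟩ := Finset.mem_Icc.1 hi
  rw [Measure.map_apply hceil (measurableSet_singleton i), Measure.restrict_apply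
    (hceil (measurableSet_singleton i))]
  have hi1' : (1 : ℝ) ≤ i := by exact_mod_cast hi1
  have hi2' : (i : ℝ) ≤ n := by exact_mod_cast hi2
  calc (n : ℝ≥0∞)⁻¹ = volume (Set.Ioc (((i : ℝ) - 1) / n) (i / n)) := by
        rw [Real.volume_Ioc, ← sub_div, sub_sub_cancel, one_div, ENNReal.ofReal_inv_of_pos hn',
          ENNReal.ofReal_natCast]
    _ ≤ _ := by
        refine measure_mono fun s hs ↦ ⟨?_, ?_, ?_⟩
        · have h1 := (div_lt_iff₀' hn').1 hs.1
          have h2 := (le_div_iff₀' hn').1 hs.2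
          rw [Set.mem_preimage, Set.mem_singleton_iff, Nat.ceil_eq_iff (by omega)]
          refine ⟨?_, h2⟩
          push_cast [Nat.cast_sub hi1]
          exact h1
        · exact le_trans (div_nonneg (by linarith) hn'.le) hs.1.le
        · exact hs.2.trans ((div_le_one hn').2 hi2')

theorem walkEnergy_le_lintegral {Ω : Type*} (S S' : ℕ → Ω → Fin 4 → ℤ) {n : ℕ} (hn : 1 ≤ n) (ω : Ω) :
    walkEnergy S S' n ω ≤ n * ∫⁻ s in Set.Icc (0 : ℝ) 1, ∫⁻ t in Set.Icc (0 : ℝ) 1,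
      greenSRW (S ⌈n * s⌉₊ ω) (S' ⌈n * t⌉₊ ω) := by
  have hn0 : (n : ℝ≥0∞) ≠ 0 := by exact_mod_cast (by omega : n ≠ 0)
  have hnt : (n : ℝ≥0∞) ≠ ∞ := ENNReal.natCast_ne_top n
  calc walkEnergy S S' n ω = n * ((n : ℝ≥0∞)⁻¹ * ∑ i ∈ Finset.Icc 1 n, ((n : ℝ≥0∞)⁻¹ *
        ∑ l ∈ Finset.Icc 1 n, greenSRW (S i ω) (S' l ω))) := by
        rw [walkEnergy, ← mul_assoc, ENNReal.mul_inv_cancel hn0 hnt, one_mul, Finset.mul_sum]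
    _ ≤ n * ((n : ℝ≥0∞)⁻¹ * ∑ i ∈ Finset.Icc 1 n, ∫⁻ t in Set.Icc (0 : ℝ) 1,
        greenSRW (S i ω) (S' ⌈n * t⌉₊ ω)) := by
        gcongr with i hi
        exact inv_mul_sum_le_lintegral n fun l ↦ greenSRW (S i ω) (S' l ω)
    _ ≤ _ := by
        gcongr
        exact inv_mul_sum_le_lintegral n fun i ↦ ∫⁻ t in Set.Icc (0 : ℝ) 1,
          greenSRW (S i ω) (S' ⌈n * t⌉₊ ω)

theorem IsSRW.lintegral_sq_sqrtGreenSRW_le [IsProbabilityMeasure P] (hS : IsSRW S P) {n : ℕ}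
    (hn : 1 ≤ n) {s t : ℝ} (hs : 0 ≤ s) (hst : s ≤ t) (x : Fin 4 → ℤ) :
    ∫⁻ z, (∫⁻ ω, ENNReal.ofReal (√n) * sqrtGreenSRW (x + (S ⌈n * t⌉₊ ω - S ⌈n * s⌉₊ ω)) z ∂P) ^ 2
      ∂Measure.count ≤ ENNReal.ofReal (5184 * Real.pi ^ 2) / ENNReal.ofReal (t - s) := by
  rcases hst.eq_or_lt with rfl | hst
  · rw [sub_self, ENNReal.ofReal_zero, ENNReal.div_zero]
    · exact le_top
    · rw [ne_eq, ENNReal.ofReal_eq_zero, not_le]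
      positivity
  have hn' : (0 : ℝ) < n := by exact_mod_cast hn
  obtain ⟨j, hj⟩ := Nat.exists_eq_add_of_le (Nat.ceil_mono
    (mul_le_mul_of_nonneg_left hst.le hn'.le))
  have hlaw := hS.hasLaw_sub ⌈n * s⌉₊ j
  rw [← hj] at hlaw
  have hz : ∀ z, ∫⁻ ω, ENNReal.ofReal (√n) * sqrtGreenSRW (x + (S ⌈n * t⌉₊ ω - S ⌈n * s⌉₊ ω)) z ∂P =
      ENNReal.ofReal (√n) * ∫⁻ ξ, sqrtGreenSRW (x + ξ) z ∂(walkLaw 0 j) := by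
    intro z
    have hm : Measurable fun ξ ↦ sqrtGreenSRW (x + ξ) z := Measurable.of_discrete
    rw [← hlaw.lintegral_comp hm.aemeasurable, lintegral_const_mul' _ _ ENNReal.ofReal_ne_top]
  rw [lintegral_count]
  simp only [hz, mul_pow]
  rw [ENNReal.tsum_mul_left]
  refine (mul_le_mul_right (lintegral_sq_sqrtGreenSRW_walkLaw_le j x) _).trans ?_
  rw [← ENNReal.ofReal_pow (by positivity), Real.sq_sqrt hn'.le,
    ← ENNReal.ofReal_mul (by positivity), ← ENNReal.ofReal_div_of_pos (sub_pos.2 hst)]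
  refine ENNReal.ofReal_le_ofReal ?_
  rw [mul_div_assoc', div_le_div_iff₀ (by positivity) (sub_pos.2 hst)]
  have h1 : n * (t - s) ≤ j + 1 := by
    have e1 := Nat.le_ceil (n * t)
    have e2 := Nat.ceil_lt_add_one (mul_nonneg hn'.le hs)
    have e3 : ((⌈n * t⌉₊ : ℕ) : ℝ) = ⌈n * s⌉₊ + j := by exact_mod_cast hj
    linarith
  calc n * (5184 * Real.pi ^ 2) * (t - s) = 5184 * Real.pi ^ 2 * (n * (t - s)) := by ring
    _ ≤ _ := by gcongr

theorem walkEnergy_moments [IsProbabilityMeasure P] {S' : ℕ → Ω → Fin 4 → ℤ}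
    (hS : IsSRW S P) (hS' : IsSRW S' P)
    (hind : IndepFun (fun ω n ↦ S n ω) (fun ω n ↦ S' n ω) P) {n : ℕ} (hn : 1 ≤ n) :
    AEMeasurable (walkEnergy S S' n) P ∧ ∀ p : ℕ, ∫⁻ ω, walkEnergy S S' n ω ^ p ∂P ≤
      ENNReal.ofReal ((5184 * Real.pi ^ 2 * Real.pi * Real.exp 2) ^ p * p.factorial) := by
  refine ⟨Measurable.aemeasurable ?_, fun p ↦ ?_⟩
  · unfold walkEnergy
    refine Measurable.const_mul (Finset.measurable_sum _ fun i _ ↦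
      Finset.measurable_sum _ fun l _ ↦ ?_) _
    exact (Measurable.of_discrete (f := fun q : (Fin 4 → ℤ) × (Fin 4 → ℤ) ↦
      greenSRW q.1 q.2)).comp ((hS.measurable i).prodMk (hS'.measurable l))
  have hτ : Monotone fun s : ℝ ↦ ⌈n * s⌉₊ := fun a b hab ↦
    Nat.ceil_mono (mul_le_mul_of_nonneg_left hab (by positivity))
  have hm : ∀ {W : ℕ → Ω → Fin 4 → ℤ}, IsSRW W P →
      Measurable (Function.uncurry fun (s : ℝ) ω ↦ W ⌈n * s⌉₊ ω) := by
    intro W hW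
    have h1 : Measurable fun q : ℕ × Ω ↦ W q.1 q.2 := measurable_from_prod_countable_right hW.measurable
    have h2 : Measurable fun q : ℝ × Ω ↦ ⌈n * q.1⌉₊ := Nat.measurable_ceil.comp (by fun_prop)
    exact h1.comp (h2.prodMk measurable_snd)
  have hzero : ∀ {W : ℕ → Ω → Fin 4 → ℤ}, IsSRW W P →
      ∀ᵐ ω ∂P, W ⌈n * (0 : ℝ)⌉₊ ω = 0 := by
    intro W hW
    simpa using hW.zero
  refine lintegral_energy_pow_le (X := fun s ω ↦ S ⌈n * s⌉₊ ω) (X' := fun s ω ↦ S' ⌈n * s⌉₊ ω)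
    (hm hS) (hasIndepIncrements_comp_monotone hS.hasIndepIncrements hτ) (hzero hS)
    (hm hS') (hasIndepIncrements_comp_monotone hS'.hasIndepIncrements hτ) (hzero hS') ?_
    (h := fun x z ↦ ENNReal.ofReal (√n) * sqrtGreenSRW x z) Measurable.of_discrete
    Measure.count (by positivity)
    (fun s t hs hst x ↦ hS.lintegral_sq_sqrtGreenSRW_le hn hs hst x)
    (fun s t hs hst x ↦ hS'.lintegral_sq_sqrtGreenSRW_le hn hs hst x) (ae_of_all _ fun ω ↦ ?_) p
  · intro p s t
    have h1 : Measurable fun (f : ℕ → Fin 4 → ℤ) (k : Fin p) ↦ f ⌈n * s k⌉₊ := by fun_prop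
    have h2 : Measurable fun (f : ℕ → Fin 4 → ℤ) (k : Fin p) ↦ f ⌈n * t k⌉₊ := by fun_prop
    exact hind.comp h1 h2
  · refine (walkEnergy_le_lintegral S S' hn ω).trans ?_
    rw [← lintegral_const_mul' _ _ (ENNReal.natCast_ne_top n)]
    refine lintegral_mono fun s ↦ ?_
    rw [← lintegral_const_mul' _ _ (ENNReal.natCast_ne_top n)]
    refine lintegral_mono fun t ↦ ?_
    simp only [mul_mul_mul_comm (ENNReal.ofReal √n)]
    rw [lintegral_count, ENNReal.tsum_mul_left, ← ENNReal.ofReal_mul (by positivity),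
      Real.mul_self_sqrt (by positivity), ENNReal.ofReal_natCast]
    gcongr
    exact greenSRW_le_tsum _ _

end

end SRW4

theorem lemma4p1 :
    ∃ C : ℝ, 0 < C ∧
      (∀ (Ω : Type*) [MeasurableSpace Ω] (P : Measure Ω) [IsProbabilityMeasure P]
        (S S' : ℕ → Ω → (Fin 4 → ℤ)),
        SRW4.IsSRW S P → SRW4.IsSRW S' P →
        IndepFun (fun ω n ↦ S n ω) (fun ω n ↦ S' n ω) P →
          (∀ n : ℕ, 1 ≤ n → AEMeasurable (SRW4.walkEnergy S S' n) P) ∧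
          (∀ p n : ℕ, 1 ≤ n →
            ∫⁻ ω, SRW4.walkEnergy S S' n ω ^ p ∂P ≤ ENNReal.ofReal (C ^ p * p.factorial)) ∧
          (∀ c : ℝ, c < 1 / C →
            (⨆ (n : ℕ) (_ : 1 ≤ n), SRW4.expMoment P (SRW4.walkEnergy S S' n) c) < ∞)) ∧
      (∀ (Ω : Type*) [MeasurableSpace Ω] (P : Measure Ω) [IsProbabilityMeasure P]
        (B B' : ℝ≥0 → Ω → EuclideanSpace ℝ (Fin 4)),
        SRW4.IsBrownianMotion B P → SRW4.IsBrownianMotion B' P →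
        IndepFun (fun ω t ↦ B t ω) (fun ω t ↦ B' t ω) P →
          AEMeasurable (SRW4.brownianEnergy B B') P ∧
          (∀ p : ℕ,
            ∫⁻ ω, SRW4.brownianEnergy B B' ω ^ p ∂P ≤ ENNReal.ofReal (C ^ p * p.factorial)) ∧
          (∀ c : ℝ, c < 1 / C → SRW4.expMoment P (SRW4.brownianEnergy B B') c < ∞)) := by
  have hpi : 0 < Real.pi := Real.pi_pos
  have hC : 0 < 5184 * Real.pi ^ 2 * Real.pi * Real.exp 2 := by positivity
  refine ⟨5184 * Real.pi ^ 2 * Real.pi * Real.exp 2, hC, ?_, ?_⟩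
  · intro Ω _ P _ S S' hS hS' hind
    have h := fun (n : ℕ) (hn : 1 ≤ n) ↦ SRW4.walkEnergy_moments hS hS' hind hn
    refine ⟨fun n hn ↦ (h n hn).1, fun p n hn ↦ (h n hn).2 p, fun c hc ↦ ?_⟩
    refine lt_of_le_of_lt (iSup₂_le fun n hn ↦ ?_) (SRW4.one_add_inv_one_sub_lt_top hC hc)
    exact SRW4.expMoment_le (h n hn).1 hC (h n hn).2 c
  · intro Ω _ P _ B B' hB hB' hind
    obtain ⟨hm, h⟩ := SRW4.brownianEnergy_moments hB hB' hind
    have h' : ∀ p : ℕ, ∫⁻ ω, SRW4.brownianEnergy B B' ω ^ p ∂P ≤ ENNReal.ofReal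
        ((5184 * Real.pi ^ 2 * Real.pi * Real.exp 2) ^ p * p.factorial) := fun p ↦ by
      refine (h p).trans (ENNReal.ofReal_le_ofReal ?_)
      gcongr
      norm_num
    exact ⟨hm, h', fun c hc ↦ lt_of_le_of_lt (SRW4.expMoment_le hm hC h' c)
      (SRW4.one_add_inv_one_sub_lt_top hC hc)⟩
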